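/- Let $d\ge 2$, $\gamma>-1$, and let $\mathbb V_0^{d+1}=\{(x,t)\in\mathbb R^d\times\mathbb R:\ \|x\|^2=t,\ 0\le t\le 1\}$ be the surface of the paraboloid. For $\alpha,\beta>-1$ let $$P_n^{(\alpha,\beta)}(t)=\frac{(\alpha+1)_n}{n!}\,{}_2F_1\!\left(-n,\,n+\alpha+\beta+1;\,\alpha+1;\,\tfrac{1-t}{2}\right)$$ be the Jacobi polynomials, and put $$w_{\alpha,\beta}(v)=(1-v)^\alpha(1+v)^\beta,\qquad c_{\alpha,\beta}=\frac{\Gamma(\alpha+\beta+2)}{\Gamma(\alpha+1)\Gamma(\beta+1)},\qquad c'_{\alpha,\beta}=2^{-\alpha-\beta-1}c_{\alpha,\beta},$$ $$h_n^{(\alpha,\beta)}=\frac{(\alpha+1)_n(\beta+1)_n(\alpha+\beta+n+1)}{n!\,(\alpha+\beta+2)_n(\alpha+\beta+2n+1)}.$$ Let $\sigma_{\mathbb S}$ be the surface measure and $\omega_d$ the surface area of $\mathbb S^{d-1}$. On $\mathbb V_0^{d+1}$ consider the weight $\varpi_{-1/2,\gamma}(t)=t^{-1/2}(1-t)^\gamma$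 and the normalized inner product $$\langle f,g\rangle=\frac{c_{\frac{d-2}{2},\gamma}}{\omega_d}\int_0^1 t^{\frac{d-1}{2}}\int_{\mathbb S^{d-1}} f(\sqrt t\,\xi,t)\,g(\sqrt t\,\xi,t)\,\varpi_{-1/2,\gamma}(t)\,d\sigma_{\mathbb S}(\xi)\,dt .$$ For each $m\ge 0$ let $\{Y_\ell^m\}_\ell$ be a basis of the space of homogeneous harmonic polynomials of degree $m$ in $d$ variables that is orthonormal with respect to $\frac1{\omega_d}d\sigma_{\mathbb S}$ on the sphere. For $0\le m\le k$ put $$\mathsf Q_{m,\ell}^k(x,t)=P_{k-m}^{(m+\frac{d-2}{2},\gamma)}(1-2t)\,t^{\frac m2}\,Y_\ell^m\!\left(\frac{x}{\sqrt t}\right)$$ (that is, $P_{k-m}^{(m+\frac{d-2}{2},\gamma)}(1-2t)\,Y_\ell^m(x)$), and define the reproducing kernels and the kernel of the $n$-th partial sum operator by $$\mathsf P_k(p,q)=\sum_{m=0}^k\sum_{\ell}\frac{\mathsf Q_{m,\ell}^k(p)\,\mathsf Q_{m,\ell}^k(q)}{\langle \mathsf Q_{m,\ell}^k,\mathsf Q_{m,\ell}^k\rangle},\qquad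 \mathsf K_n(\varpi_{-1/2,\gamma};p,q)=\sum_{k=0}^n\mathsf P_k(p,q).$$ Then for every $n\ge 0$, $\xi\in\mathbb S^{d-1}$ and $(y,s)\in\mathbb V_0^{d+1}$, $$\mathsf K_n\big(\varpi_{-1/2,\gamma};(\xi,1),(y,s)\big)=\frac{P_n^{(\gamma+\frac d2,\frac{d-2}2)}(1)}{h_n^{(\gamma+\frac d2,\frac{d-2}2)}}\;c'_{\gamma+\frac d2,\frac{d-2}2}\int_{-1}^1 P_n^{(\gamma+\frac d2,\frac{d-2}2)}\big(z'(\xi,y,v)\big)\,w_{\gamma+\frac d2,\frac{d-2}2}(v)\,dv,$$ where $$z'(\xi,y,v)=1-(1-v^2)\big(1-\langle\xi,y\rangle\big)-\tfrac12(1-v)^2(1-s).$$ -/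

import Mathlib

open MeasureTheory

namespace Paraboloid

/-- The Pochhammer symbol `(a)_n = a (a+1) ⋯ (a+n-1)`. -/
noncomputable def poch (a : ℝ) (n : ℕ) : ℝ := (ascPochhammer ℝ n).eval a

/-- The Jacobi polynomial
`P_n^{(α,β)}(t) = (α+1)_n / n! * ₂F₁(-n, n+α+β+1; α+1; (1-t)/2)`. -/
noncomputable def jacobiP (n : ℕ) (α β t : ℝ) : ℝ :=
  poch (α + 1) n / (n.factorial : ℝ) *
    ordinaryHypergeometric (-(n : ℝ)) ((n : ℝ) + α + β + 1) (α + 1) ((1 - t) / 2)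

/-- The Jacobi weight `w_{α,β}(x) = (1-x)^α (1+x)^β`. -/
noncomputable def jacobiWeight (α β x : ℝ) : ℝ := (1 - x) ^ α * (1 + x) ^ β

/-- `c_{α,β} = Γ(α+β+2) / (Γ(α+1) Γ(β+1))`, the reciprocal of `∫_0^1 t^α (1-t)^β dt`. -/
noncomputable def jacobiC (α β : ℝ) : ℝ :=
  Real.Gamma (α + β + 2) / (Real.Gamma (α + 1) * Real.Gamma (β + 1))

/-- `c'_{α,β} = 2^{-α-β-1} c_{α,β}`, the reciprocal of `∫_{-1}^1 w_{α,β}(t) dt`. -/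
noncomputable def jacobiC' (α β : ℝ) : ℝ := (2 : ℝ) ^ (-α - β - 1) * jacobiC α β

/-- The normalized square norm `h_n^{(α,β)}` of the Jacobi polynomial `P_n^{(α,β)}`. -/
noncomputable def jacobiH (n : ℕ) (α β : ℝ) : ℝ :=
  (poch (α + 1) n * poch (β + 1) n * (α + β + n + 1)) /
    ((n.factorial : ℝ) * poch (α + β + 2) n * (α + β + 2 * n + 1))

/-- The surface of the paraboloid `{(x,t) : ‖x‖² = t, 0 ≤ t ≤ 1}`, with `x ∈ ℝ^d`. -/
def surface (d : ℕ) : Set (EuclideanSpace ℝ (Fin d) × ℝ) :=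
  {p | ‖p.1‖ ^ 2 = p.2 ∧ 0 ≤ p.2 ∧ p.2 ≤ 1}

/-- The surface area `ω_d` of the unit sphere of `ℝ^d`. -/
noncomputable def sphereArea (d : ℕ) : ℝ :=
  2 * Real.pi ^ ((d : ℝ) / 2) / Real.Gamma ((d : ℝ) / 2)

/-- The integral of `f` over the unit sphere of `ℝ^d` for the surface measure. -/
noncomputable def sphereIntegral (d : ℕ) (f : EuclideanSpace ℝ (Fin d) → ℝ) : ℝ :=
  ∫ ξ : Metric.sphere (0 : EuclideanSpace ℝ (Fin d)) 1, f ξ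
    ∂((volume : Measure (EuclideanSpace ℝ (Fin d))).toSphere)

/-- The integral over the surface of the paraboloid for
`dσ(x,t) = t^{(d-1)/2} dσ_S(ξ) dt`, where `x = √t ξ`. -/
noncomputable def surfaceIntegral (d : ℕ) (f : EuclideanSpace ℝ (Fin d) × ℝ → ℝ) : ℝ :=
  ∫ t in (0 : ℝ)..1, t ^ (((d : ℝ) - 1) / 2) * sphereIntegral d (fun ξ => f (Real.sqrt t • ξ, t))

/-- The weight `ϖ_{β,γ}(t) = t^β (1-t)^γ`. -/
noncomputable def surfaceWeight (β γ t : ℝ) : ℝ := t ^ β * (1 - t) ^ γ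

/-- The normalized inner product `⟨f,g⟩_{β,γ}` on the surface of the paraboloid. -/
noncomputable def surfaceInner (d : ℕ) (β γ : ℝ)
    (f g : EuclideanSpace ℝ (Fin d) × ℝ → ℝ) : ℝ :=
  (1 / sphereArea d * jacobiC (β + ((d : ℝ) - 1) / 2) γ) *
    surfaceIntegral d (fun p => f p * g p * surfaceWeight β γ p.2)

/-- The Laplace operator on polynomials in `d` variables. -/
noncomputable def laplacian (d : ℕ) : MvPolynomial (Fin d) ℝ →ₗ[ℝ] MvPolynomial (Fin d) ℝ :=
  ∑ i : Fin d, (MvPolynomial.pderiv i).toLinearMap ∘ₗ (MvPolynomial.pderiv i).toLinearMap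

/-- The space of homogeneous harmonic polynomials of degree `m` in `d` variables. Restriction
to the unit sphere identifies it with the space of spherical harmonics of degree `m`. -/
noncomputable def harmonicSpace (d m : ℕ) : Submodule ℝ (MvPolynomial (Fin d) ℝ) :=
  MvPolynomial.homogeneousSubmodule (Fin d) ℝ m ⊓ LinearMap.ker (laplacian d)

/-- A choice, for every degree `m`, of a basis `Y_ℓ^m`, `1 ≤ ℓ ≤ dim`, of the spherical
harmonics of degree `m`. -/
abbrev HarmonicBasis (d : ℕ) : Type :=
  ∀ m : ℕ, Module.Basis (Fin (Module.finrank ℝ (harmonicSpace d m))) ℝ (harmonicSpace d m)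

/-- The value of `Y_ℓ^m` at the point `x`. -/
noncomputable def HarmonicBasis.val {d : ℕ} (Y : HarmonicBasis d) (m : ℕ)
    (l : Fin (Module.finrank ℝ (harmonicSpace d m))) (x : EuclideanSpace ℝ (Fin d)) : ℝ :=
  MvPolynomial.eval (fun i => x i) (Y m l : MvPolynomial (Fin d) ℝ)

/-- In every degree, the basis is orthonormal for the normalized surface measure of the
sphere. -/
def HarmonicBasis.IsOrthonormal {d : ℕ} (Y : HarmonicBasis d) : Prop :=
  ∀ (m : ℕ) (l l' : Fin (Module.finrank ℝ (harmonicSpace d m))),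
    1 / sphereArea d * sphereIntegral d (fun ξ => Y.val m l ξ * Y.val m l' ξ) =
      if l = l' then 1 else 0

/-- The basis function
`Q_{m,ℓ}^n(x,t) = P_{n-m}^{(β+m+(d-1)/2,γ)}(1-2t) t^{m/2} Y_ℓ^m(x/√t)`, for `m ≤ n`.
On the surface this is `P_{n-m}(1-2t) Y_ℓ^m(x)`, also at the apex `t = 0`, where `x = 0`. -/
noncomputable def basisQ {d : ℕ} (β γ : ℝ) (Y : HarmonicBasis d) (n m : ℕ)
    (l : Fin (Module.finrank ℝ (harmonicSpace d m))) (p : EuclideanSpace ℝ (Fin d) × ℝ) : ℝ :=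
  jacobiP (n - m) (β + m + ((d : ℝ) - 1) / 2) γ (1 - 2 * p.2) *
    (p.2 ^ ((m : ℝ) / 2) * Y.val m l ((Real.sqrt p.2)⁻¹ • p.1))

/-- The reproducing kernel of the orthogonal polynomials of degree `n` on the surface,
`P_n(ϖ_{β,γ}; p, q) = ∑_{m ≤ n} ∑_ℓ Q_{m,ℓ}^n(p) Q_{m,ℓ}^n(q) / ⟨Q_{m,ℓ}^n, Q_{m,ℓ}^n⟩`. -/
noncomputable def kernelP {d : ℕ} (β γ : ℝ) (Y : HarmonicBasis d) (n : ℕ)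
    (p q : EuclideanSpace ℝ (Fin d) × ℝ) : ℝ :=
  ∑ m ∈ Finset.range (n + 1), ∑ l : Fin (Module.finrank ℝ (harmonicSpace d m)),
    basisQ β γ Y n m l p * basisQ β γ Y n m l q /
      surfaceInner d β γ (basisQ β γ Y n m l) (basisQ β γ Y n m l)

/-- The kernel `K_n = ∑_{k ≤ n} P_k` of the partial sum operator. -/
noncomputable def kernelK {d : ℕ} (β γ : ℝ) (Y : HarmonicBasis d) (n : ℕ)
    (p q : EuclideanSpace ℝ (Fin d) × ℝ) : ℝ :=
  ∑ k ∈ Finset.range (n + 1), kernelP β γ Y k p q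

/-- `z'(ξ, (y,s), v) = 1 - (1-v²)(1-⟨ξ,y⟩) - (1-v)²(1-s)/2`. -/
noncomputable def zPrime {d : ℕ} (ξ y : EuclideanSpace ℝ (Fin d)) (s v : ℝ) : ℝ :=
  1 - (1 - v ^ 2) * (1 - inner ℝ ξ y) - 1 / 2 * (1 - v) ^ 2 * (1 - s)

end Paraboloid

/-! Put `b = (d-2)/2` and `a = γ + d/2 = γ + b + 1`. Both sides are combinations of the products
`s^i * Z_m(ξ,y)`, where `Z_m` is the reproducing kernel `zonalKernel` of the harmonics of degree
`m`. The proof computes both families of coefficients and finds the same closed form, `kernelCoeff a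
b m i (n-m-i)`.

Kernel side (`kernelK_eq_sum`). At `t = 1` the Jacobi factors are evaluated at `-1`. With `m` fixed,
the sum over the total degree is a Christoffel–Darboux kernel at that endpoint, and its coefficients
telescope to a closed form (`sum_jacobiP_neg_one_mul`).

Integral side (`jacobiP_zPrime_eq_sum`). With `v = 2u - 1`, the relations `‖ξ‖ = 1` and `‖y‖² = s`
give `z' = 2‖uξ + (1-u)y‖² - 1`. So `P_n(z')` is a polynomial in `‖uξ + (1-u)y‖²`, whose powers
expand in zonal kernels (`norm_add_pow_eq_sum`). Every term then depends on `u` through `u^(m+2l)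
(1-u)^(m+2i)`, a beta integral. What is left is a terminating hypergeometric sum over `l`, evaluated
by `sum_poch_four_F_three`.

The expansion of `‖x+y‖^(2j)` comes from harmonic analysis on the sphere: up to a constant it is the
mean of `⟨x+y,·⟩^(2j)`. The binomial theorem, the expansion of `⟨x,·⟩^k` in zonal harmonics
(`linForm_pow_eq_sum`) and orthogonality do the rest. All these means follow from one recursion,
`k(k+d-2) mean(p) = mean(Δp)` for `p` homogeneous of degree `k` (`sphereMean_laplacian`), proved by
integrating by parts against a Gaussian. -/

namespace Paraboloid

/-! ### Pochhammer symbols and terminating hypergeometric sums. -/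

section Pochhammer

@[simp] lemma poch_zero (a : ℝ) : poch a 0 = 1 := by simp [poch]

lemma poch_succ (a : ℝ) (n : ℕ) : poch a (n + 1) = poch a n * (a + n) :=
  ascPochhammer_succ_eval n a

lemma poch_add (a : ℝ) (m n : ℕ) : poch a (m + n) = poch a m * poch (a + m) n := by
  induction n with
  | zero => simp
  | succ n ih => rw [← add_assoc, poch_succ, ih, poch_succ]; push_cast; ring

lemma poch_succ_left (a : ℝ) (n : ℕ) : poch a (n + 1) = a * poch (a + 1) n := by
  rw [add_comm, poch_add, poch_succ]; simp

lemma poch_pos {a : ℝ} (ha : 0 < a) (n : ℕ) : 0 < poch a n := ascPochhammer_pos n a ha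

lemma poch_one (n : ℕ) : poch 1 n = n.factorial := ascPochhammer_eval_one ℝ n

/-- Reversing the order of the `n` factors changes the sign of each one. -/
lemma poch_neg (x : ℝ) (n : ℕ) : poch (-x - n + 1) n = (-1) ^ n * poch x n := by
  induction n with
  | zero => simp
  | succ n ih =>
    rw [poch_succ_left, poch_succ, pow_succ,
      show -x - ((n + 1 : ℕ) : ℝ) + 1 + 1 = -x - n + 1 by push_cast; ring, ih]
    push_cast; ring

lemma factorial_eq_mul_poch (i m : ℕ) :
    ((m + i).factorial : ℝ) = m.factorial * poch (m + 1) i := by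
  rw [← factorial_mul_ascPochhammer ℝ m i]; rfl

lemma poch_neg_nat {n i : ℕ} (h : i ≤ n) :
    poch (-(n : ℝ)) i = (-1) ^ i * (n.factorial / (n - i).factorial) := by
  obtain ⟨m, rfl⟩ := Nat.exists_eq_add_of_le' h
  have h1 : ((m.factorial : ℕ) : ℝ) ≠ 0 := by positivity
  rw [Nat.add_sub_cancel, factorial_eq_mul_poch, mul_div_cancel_left₀ _ h1, ← poch_neg]
  congr 1; push_cast; ring

lemma poch_neg_nat_of_lt {n i : ℕ} (h : n < i) : poch (-(n : ℝ)) i = 0 := by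
  obtain ⟨m, rfl⟩ := Nat.exists_eq_add_of_lt h
  rw [show n + m + 1 = (n + 1) + m by ring, poch_add, poch_succ]; simp

/-- The Chu–Vandermonde identity. -/
lemma chu_vandermonde (N : ℕ) (b c : ℝ) :
    ∑ i ∈ Finset.range (N + 1), (-1) ^ i * (N.choose i : ℝ) * poch b i * poch (c + i) (N - i) =
      poch (c - b) N := by
  induction N generalizing b c with
  | zero => simp
  | succ N ih =>
    rw [Finset.sum_range_succ']
    -- Pascal's rule splits the sum in two. One part is `-b` times the induction hypothesis at
    -- `(b+1, c+1)`. The other, joined with the term `i = 0`, is `c + N` times the induction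
    -- hypothesis at `(b, c)`.
    have h1 : ∑ i ∈ Finset.range (N + 1), (-1) ^ (i + 1) * ((N + 1).choose (i + 1) : ℝ) *
        poch b (i + 1) * poch (c + (i + 1 : ℕ)) (N + 1 - (i + 1)) =
        - b * poch (c - b) N + ∑ i ∈ Finset.range (N + 1), (-1) ^ (i + 1) *
          (N.choose (i + 1) : ℝ) * poch b (i + 1) * poch (c + (i + 1 : ℕ)) (N + 1 - (i + 1)) := by
      rw [show c - b = (c + 1) - (b + 1) by ring, ← ih, Finset.mul_sum, ← Finset.sum_add_distrib]
      refine Finset.sum_congr rfl fun i _ => ?_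
      rw [Nat.choose_succ_succ, Nat.add_sub_add_right, poch_succ_left,
        show c + ((i + 1 : ℕ) : ℝ) = c + 1 + i by push_cast; ring]
      push_cast; ring
    have h2 : ∑ i ∈ Finset.range (N + 1), (-1) ^ (i + 1) *
          (N.choose (i + 1) : ℝ) * poch b (i + 1) * poch (c + (i + 1 : ℕ)) (N + 1 - (i + 1)) +
        (-1) ^ 0 * ((N + 1).choose 0 : ℝ) * poch b 0 * poch (c + (0 : ℕ)) (N + 1 - 0) =
        (c + N) * poch (c - b) N := by
      have h3 := Finset.sum_range_succ' (fun i => (-1) ^ i * (N.choose i : ℝ) * poch b i *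
        poch (c + i) (N + 1 - i)) (N + 1)
      rw [Finset.sum_range_succ, Nat.choose_succ_self] at h3
      rw [← ih, Finset.mul_sum]
      simp only [Nat.choose_zero_right, Nat.cast_zero, mul_zero, zero_mul, add_zero] at h3 ⊢
      rw [← h3]
      refine Finset.sum_congr rfl fun i hi => ?_
      have hi' : i ≤ N := Nat.lt_succ_iff.mp (Finset.mem_range.mp hi)
      rw [Nat.succ_sub hi', poch_succ, Nat.cast_sub hi']; ring
    rw [h1, add_assoc, h2, poch_succ]; ring

/-- Up to the sign `(-1)^N` this is the `N`-th forward difference of `Q` at `0`, which kills degrees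
below `N`. -/
lemma sum_neg_one_pow_choose_mul_eval {N : ℕ} {Q : Polynomial ℝ} (hQ : Q.natDegree < N) :
    ∑ l ∈ Finset.range (N + 1), (-1) ^ l * (N.choose l : ℝ) * Q.eval (l : ℝ) = 0 := by
  have h := congrFun (Polynomial.fwdDiff_iter_eq_zero_of_degree_lt hQ) 0
  rw [fwdDiff_iter_eq_sum_shift] at h
  have h2 : (-1 : ℝ) ^ N * ∑ l ∈ Finset.range (N + 1), (-1) ^ l * (N.choose l : ℝ) *
      Q.eval (l : ℝ) = 0 := by
    rw [Finset.mul_sum]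
    refine Eq.trans (Finset.sum_congr rfl fun l hl => ?_) h
    obtain ⟨m, rfl⟩ := Nat.exists_eq_add_of_le (Nat.lt_succ_iff.mp (Finset.mem_range.mp hl))
    have : ((-1 : ℝ) ^ l) * (-1) ^ l = 1 := by rw [← mul_pow]; simp
    simp only [zsmul_eq_mul, Nat.add_sub_cancel_left, zero_add, nsmul_eq_mul, mul_one]
    push_cast
    rw [pow_add]; linear_combination (-1) ^ m * ((l + m).choose l : ℝ) * Q.eval (l : ℝ) * this
  simpa using h2

-- With `N = k + r + 1`, regrouping the Pochhammer symbols turns the quotient into `(B+2l)_k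
-- (B+k+l)_r / (B)_{k+r}`. This is a polynomial in `l` of degree at most `N - 1`, so its `N`-th
-- difference vanishes.
open Polynomial in
lemma sum_poch_eq_zero {N k : ℕ} (hk : k < N) {B : ℝ} (hB : 0 < B) :
    ∑ l ∈ Finset.range (N + 1), (-1) ^ l * (N.choose l : ℝ) * poch (N + B - 1) l *
      poch (B + k + l) l / poch B (2 * l) = 0 := by
  obtain ⟨r, rfl⟩ := Nat.exists_eq_add_of_lt hk
  set Q : ℝ[X] := (ascPochhammer ℝ k).comp (C 2 * X + C B) *
    (ascPochhammer ℝ r).comp (X + C (B + k)) with hQ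
  have hdeg : Q.natDegree < k + r + 1 := by
    refine Nat.lt_succ_iff.mpr (natDegree_mul_le.trans (Nat.add_le_add ?_ ?_)) <;>
    · refine natDegree_comp_le.trans ?_
      rw [ascPochhammer_natDegree]
      refine (Nat.mul_le_mul_left _ ?_).trans (mul_one _).le
      compute_degree
  have h := sum_neg_one_pow_choose_mul_eval hdeg
  have h2 : ∑ l ∈ Finset.range (k + r + 1 + 1), (-1) ^ l * ((k + r + 1).choose l : ℝ) *
      poch ((k + r + 1 : ℕ) + B - 1) l * poch (B + k + l) l / poch B (2 * l) =
      (poch B (k + r))⁻¹ * ∑ l ∈ Finset.range (k + r + 1 + 1), (-1) ^ l *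
        ((k + r + 1).choose l : ℝ) * Q.eval (l : ℝ) := by
    rw [Finset.mul_sum]
    refine Finset.sum_congr rfl fun l _ => ?_
    have e : Q.eval (l : ℝ) = poch (B + 2 * l) k * poch (B + k + l) r := by
      simp only [hQ, eval_mul, eval_comp, eval_add, eval_C, eval_X, poch]
      congr 2 <;> ring_nf
    have e1 : poch B (2 * l) * poch (B + 2 * l) k = poch B (k + l) * poch (B + k + l) l := by
      have a1 := poch_add B (2 * l) k
      have a2 := poch_add B (k + l) l
      rw [show k + l + l = 2 * l + k by ring, a1] at a2
      push_cast at a2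
      rw [a2, add_assoc]
    have e2 : poch B (k + r) * poch (k + r + B) l = poch B (k + l) * poch (B + k + l) r := by
      have a1 := poch_add B (k + r) l
      have a2 := poch_add B (k + l) r
      rw [show k + l + r = k + r + l by ring, a1] at a2
      push_cast at a2
      rw [add_comm B] at a2
      rw [a2, add_assoc B]
    have p1 := (poch_pos hB (2 * l)).ne'
    have p2 := (poch_pos hB (k + r)).ne'
    have p3 := (poch_pos hB (k + l)).ne'
    rw [e, show ((k + r + 1 : ℕ) : ℝ) + B - 1 = k + r + B by push_cast; ring]
    generalize poch (B + 2 * (l : ℝ)) k = t at e1 ⊢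
    field_simp
    apply mul_left_cancel₀ p3
    linear_combination ((k + r + 1).choose l : ℝ) *
      ((poch (B + k + l) l * poch B (k + l)) * e2 - poch B (k + l) * poch (B + k + l) r * e1)
  rw [h2, h, mul_zero]

open Polynomial in
/-- A terminating Saalschützian `₄F₃` at unit argument. -/
lemma sum_poch_four_F_three (N : ℕ) (A : ℝ) {B : ℝ} (hB : 1 < B) :
    ∑ l ∈ Finset.range (N + 1), (-1) ^ l * (N.choose l : ℝ) * poch (N + B - 1) l *
      poch (A + l) l / poch B (2 * l) =
    poch (B - A) N * (B + N - 1) / (poch B N * (B + 2 * N - 1)) := by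
  -- For `N = 0` the right side is `(B-1)/(B-1)`, hence the need for `B ≠ 1`.
  rcases Nat.eq_zero_or_pos N with rfl | hN
  · have : B - 1 ≠ 0 := by linarith
    simp [this]
  obtain ⟨M, rfl⟩ := Nat.exists_eq_add_of_le' hN
  set N := M + 1 with hNM
  have hB0 : 0 < B := by linarith
  set co : ℕ → ℝ := fun l => (-1) ^ l * (N.choose l : ℝ) * poch (N + B - 1) l / poch B (2 * l)
    with hco
  set p : ℝ[X] := ∑ l ∈ Finset.range (N + 1), C (co l) * (ascPochhammer ℝ l).comp (X + C (l : ℝ))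
    with hp
  set κ : ℝ := (B + N - 1) / (poch B N * (B + 2 * N - 1)) with hκ
  set q : ℝ[X] := C κ * (ascPochhammer ℝ N).comp (C B - X) with hq
  have evp : ∀ x, p.eval x = ∑ l ∈ Finset.range (N + 1), (-1) ^ l * (N.choose l : ℝ) *
      poch (N + B - 1) l * poch (x + l) l / poch B (2 * l) := fun x => by
    rw [hp, eval_finsetSum]
    refine Finset.sum_congr rfl fun l _ => ?_
    simp only [hco, eval_mul, eval_C, eval_comp, eval_add, eval_X, poch]; ring
  have evq : ∀ x, q.eval x = κ * poch (B - x) N := fun x => by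
    simp [hq, poch]
  -- Both sides are polynomials in `A`. Their terms of degree `N` agree, so the difference has
  -- degree below `N`; and both vanish at the `N` points `A = B + k`, `k < N`.
  suffices h : p = q by
    rw [← evp, h, evq, hκ]; ring
  have cN : co N = (-1) ^ N * κ := by
    have e1 : poch B (2 * N) = poch B M * poch (N + B - 1) N * (B + 2 * N - 1) := by
      rw [show 2 * N = M + N + 1 by omega, poch_succ, poch_add,
        show (N : ℝ) + B - 1 = B + M by rw [hNM]; push_cast; ring]
      congr 1; rw [hNM]; push_cast; ring
    have e2 : poch B N = poch B M * (B + N - 1) := by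
      rw [hNM, poch_succ]; push_cast; ring
    have hN1 : (1 : ℝ) ≤ N := by exact_mod_cast hN
    have q1 : B + N - 1 ≠ 0 := by linarith
    have q2 : B + 2 * N - 1 ≠ 0 := by linarith
    have q3 := (poch_pos (a := N + B - 1) (by linarith) N).ne'
    have q4 := (poch_pos hB0 M).ne'
    simp only [hco, hκ, e1, e2, Nat.choose_self]
    field_simp
    simp
  have hC : ∀ (c : ℝ) (f : ℝ[X]), (C c * f).degree ≤ f.degree := fun c f =>
    (degree_mul_le _ _).trans ((add_le_add_left degree_C_le _).trans (zero_add _).le)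
  have mon : ∀ l : ℕ, ((ascPochhammer ℝ l).comp (X + C (l : ℝ))).Monic := fun l =>
    (monic_ascPochhammer ℝ l).comp_X_add_C _
  have ndg : ∀ l : ℕ, ((ascPochhammer ℝ l).comp (X + C (l : ℝ))).natDegree = l := fun l => by
    rw [natDegree_comp, natDegree_X_add_C, ascPochhammer_natDegree, mul_one]
  have hqd : (ascPochhammer ℝ N).comp (C B - X) =
      C ((-1) ^ N) * (ascPochhammer ℝ N).comp (X + C (1 - B - N)) := by
    refine Polynomial.funext fun x => ?_
    have := poch_neg (B - x) N
    simp only [eval_comp, eval_sub, eval_C, eval_X, eval_mul, eval_add]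
    change poch (B - x) N = (-1) ^ N * poch (x + (1 - B - N)) N
    rw [show x + (1 - B - N) = -(B - x) - N + 1 by ring, this, ← mul_assoc, ← mul_pow]
    simp
  refine eq_of_degree_sub_lt_of_eval_finset_eq
    ((Finset.range N).image fun k : ℕ => B + (k : ℝ)) ?_ ?_
  · rw [Finset.card_image_of_injective _ (fun a b h => by simpa using h), Finset.card_range]
    have dec : p - q = (∑ l ∈ Finset.range N, C (co l) * (ascPochhammer ℝ l).comp (X + C (l : ℝ))) +
        C (co N) * ((ascPochhammer ℝ N).comp (X + C (N : ℝ)) -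
          (ascPochhammer ℝ N).comp (X + C (1 - B - N))) := by
      rw [hp, Finset.sum_range_succ, hq, hqd, cN]
      simp only [C_mul]
      ring
    rw [dec]
    refine (degree_add_le _ _).trans_lt (max_lt ?_ ?_)
    · refine (degree_sum_le _ _).trans_lt ?_
      rw [Finset.sup_lt_iff (WithBot.bot_lt_coe _)]
      intro l hl
      refine (hC _ _).trans_lt (degree_le_natDegree.trans_lt ?_)
      rw [ndg]
      exact_mod_cast Finset.mem_range.mp hl
    · refine (hC _ _).trans_lt ?_
      have m2 := (monic_ascPochhammer ℝ N).comp_X_add_C (1 - B - N)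
      have d2 : ((ascPochhammer ℝ N).comp (X + C (1 - B - N))).natDegree = N := by
        rw [natDegree_comp, natDegree_X_add_C, ascPochhammer_natDegree, mul_one]
      have := degree_sub_lt_left (p := (ascPochhammer ℝ N).comp (X + C (N : ℝ)))
        (q := (ascPochhammer ℝ N).comp (X + C (1 - B - N)))
        (by rw [degree_eq_natDegree (mon N).ne_zero, degree_eq_natDegree m2.ne_zero, ndg, d2])
        (mon N).ne_zero (by rw [(mon N).leadingCoeff, m2.leadingCoeff])
      rwa [degree_eq_natDegree (mon N).ne_zero, ndg] at this
  · intro x hx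
    obtain ⟨k, hk, rfl⟩ := Finset.mem_image.mp hx
    have hk' := Finset.mem_range.mp hk
    rw [evp, sum_poch_eq_zero hk' hB0, evq]
    rw [show B - (B + k) = -(k : ℝ) by ring, poch_neg_nat_of_lt hk', mul_zero]

end Pochhammer

/-! ### Beta integrals on `[0,1]` and their normalization. -/

section Beta

lemma Gamma_add_nat {x : ℝ} (hx : 0 < x) (p : ℕ) :
    Real.Gamma (x + p) = poch x p * Real.Gamma x := by
  induction p with
  | zero => simp
  | succ p ih =>
    rw [Nat.cast_succ, ← add_assoc, Real.Gamma_add_one (by positivity), ih, poch_succ]; ring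

lemma intervalIntegrable_beta {α β : ℝ} (hα : -1 < α) (hβ : -1 < β) :
    IntervalIntegrable (fun t : ℝ => t ^ α * (1 - t) ^ β) volume 0 1 := by
  have h := Complex.betaIntegral_convergent (u := ((α + 1 : ℝ) : ℂ)) (v := ((β + 1 : ℝ) : ℂ))
    (by simpa using by linarith) (by simpa using by linarith)
  rw [intervalIntegrable_iff_integrableOn_Ioc_of_le zero_le_one] at h ⊢
  refine (integrableOn_congr_fun (fun x hx => ?_) measurableSet_Ioc).mp h.re
  simp only [Set.mem_Ioc] at hx
  have e : (x : ℂ) ^ (((α + 1 : ℝ) : ℂ) - 1) * (1 - x) ^ (((β + 1 : ℝ) : ℂ) - 1) =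
      ((x ^ α * (1 - x) ^ β : ℝ) : ℂ) := by
    rw [Complex.ofReal_mul, Complex.ofReal_cpow hx.1.le,
      Complex.ofReal_cpow (sub_nonneg.mpr hx.2)]
    push_cast; ring_nf
  exact (congrArg Complex.re e).trans (Complex.ofReal_re _)

lemma integral_beta {α β : ℝ} (hα : -1 < α) (hβ : -1 < β) :
    ∫ t in (0 : ℝ)..1, t ^ α * (1 - t) ^ β = (jacobiC α β)⁻¹ := by
  have h := Complex.Gamma_mul_Gamma_eq_betaIntegral (s := ((α + 1 : ℝ) : ℂ))
    (t := ((β + 1 : ℝ) : ℂ)) (by simpa using by linarith) (by simpa using by linarith)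
  have e : Complex.betaIntegral ((α + 1 : ℝ) : ℂ) ((β + 1 : ℝ) : ℂ) =
      ((∫ t in (0 : ℝ)..1, t ^ α * (1 - t) ^ β : ℝ) : ℂ) := by
    rw [Complex.betaIntegral, ← intervalIntegral.integral_ofReal]
    refine intervalIntegral.integral_congr fun x hx => ?_
    rw [Set.uIcc_of_le zero_le_one] at hx
    rw [Complex.ofReal_mul, Complex.ofReal_cpow hx.1, Complex.ofReal_cpow (sub_nonneg.mpr hx.2)]
    push_cast; ring_nf
  rw [e, ← Complex.ofReal_add, Complex.Gamma_ofReal, Complex.Gamma_ofReal, Complex.Gamma_ofReal]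
    at h
  have h' : Real.Gamma (α + 1) * Real.Gamma (β + 1) = Real.Gamma (α + 1 + (β + 1)) *
      ∫ t in (0 : ℝ)..1, t ^ α * (1 - t) ^ β := by exact_mod_cast h
  rw [show α + 1 + (β + 1) = α + β + 2 by ring] at h'
  have hg := (Real.Gamma_pos_of_pos (show 0 < α + β + 2 by linarith)).ne'
  rw [jacobiC, inv_div, h', mul_div_cancel_left₀ _ hg]

lemma jacobiC_pos {α β : ℝ} (hα : -1 < α) (hβ : -1 < β) : 0 < jacobiC α β :=
  div_pos (Real.Gamma_pos_of_pos (by linarith)) (mul_pos (Real.Gamma_pos_of_pos (by linarith))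
    (Real.Gamma_pos_of_pos (by linarith)))

/-- Integer shifts of the parameters change the Gamma factors by Pochhammer symbols. This gives the
moments, and later the norms of the basis functions. -/
lemma jacobiC_add {α β : ℝ} (hα : -1 < α) (hβ : -1 < β) (p q : ℕ) :
    jacobiC α β = jacobiC (α + p) (β + q) *
      (poch (α + 1) p * poch (β + 1) q / poch (α + β + 2) (p + q)) := by
  have h1 := (Real.Gamma_pos_of_pos (show 0 < α + 1 by linarith)).ne'
  have h2 := (Real.Gamma_pos_of_pos (show 0 < β + 1 by linarith)).ne'
  have h3 := (poch_pos (show 0 < α + β + 2 by linarith) (p + q)).ne'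
  have h4 := (poch_pos (show 0 < α + 1 by linarith) p).ne'
  have h5 := (poch_pos (show 0 < β + 1 by linarith) q).ne'
  rw [jacobiC, jacobiC, show α + p + (β + q) + 2 = α + β + 2 + (p + q : ℕ) by push_cast; ring,
    add_right_comm α p 1, add_right_comm β q 1, Gamma_add_nat (by linarith), Gamma_add_nat (by linarith),
    Gamma_add_nat (by linarith)]
  field_simp

/-- The integral over `[0, 1]` against the normalized weight `t^α (1-t)^β`. -/
noncomputable def betaMean (α β : ℝ) (f : ℝ → ℝ) : ℝ :=
  jacobiC α β * ∫ t in (0 : ℝ)..1, t ^ α * (1 - t) ^ β * f t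

lemma betaMean_sum {α β : ℝ} (hα : -1 < α) (hβ : -1 < β) {ι : Type*} (s : Finset ι)
    (c : ι → ℝ) (f : ι → ℝ → ℝ) (hf : ∀ i, Continuous (f i)) :
    betaMean α β (fun t => ∑ i ∈ s, c i * f i t) = ∑ i ∈ s, c i * betaMean α β (f i) := by
  simp only [betaMean, Finset.mul_sum]
  have hi : ∀ i ∈ s, IntervalIntegrable (fun t : ℝ => t ^ α * (1 - t) ^ β * (c i * f i t))
      volume 0 1 := fun i _ =>
    (intervalIntegrable_beta hα hβ).mul_continuousOn (continuous_const.mul (hf i)).continuousOn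
  rw [intervalIntegral.integral_finsetSum hi, Finset.mul_sum]
  refine Finset.sum_congr rfl fun i _ => ?_
  rw [mul_left_comm]
  congr 1
  rw [← intervalIntegral.integral_const_mul]
  congr 1; funext t; ring

lemma betaMean_pow {α β : ℝ} (hα : -1 < α) (hβ : -1 < β) (p q : ℕ) :
    betaMean α β (fun t => t ^ p * (1 - t) ^ q) =
      poch (α + 1) p * poch (β + 1) q / poch (α + β + 2) (p + q) := by
  have hp : -1 < α + p := by have := p.cast_nonneg (α := ℝ); linarith
  have hq : -1 < β + q := by have := q.cast_nonneg (α := ℝ); linarith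
  have h : ∫ t in (0 : ℝ)..1, t ^ α * (1 - t) ^ β * (t ^ p * (1 - t) ^ q) =
      ∫ t in (0 : ℝ)..1, t ^ (α + p) * (1 - t) ^ (β + q) := by
    refine intervalIntegral.integral_congr_Ioo_of_le zero_le_one fun t ht => ?_
    rw [Real.rpow_add ht.1, Real.rpow_add (sub_pos.mpr ht.2), Real.rpow_natCast,
      Real.rpow_natCast]
    ring
  rw [betaMean, h, integral_beta hp hq, jacobiC_add hα hβ p q, mul_right_comm,
    mul_inv_cancel₀ (jacobiC_pos hp hq).ne', one_mul]

end Beta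

/-! ### Jacobi polynomials: coefficients, reflection and norms. -/

section Jacobi

/-- The coefficient of `s^i` in `P_n^{(α,β)}(1-2s)`. -/
noncomputable def jacobiCoeff (n : ℕ) (α β : ℝ) (i : ℕ) : ℝ :=
  (-1) ^ i * (poch (α + 1 + i) (n - i) * poch (n + α + β + 1) i /
    ((n - i).factorial * i.factorial))

/-- The series stops at `i = n` because `(-n)_i = 0` beyond; `α > -1` keeps the denominators
`(α+1)_i` nonzero. -/
lemma jacobiP_one_sub_two_mul (n : ℕ) {α : ℝ} (hα : -1 < α) (β s : ℝ) :
    jacobiP n α β (1 - 2 * s) = ∑ i ∈ Finset.range (n + 1), jacobiCoeff n α β i * s ^ i := by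
  rw [jacobiP, ordinaryHypergeometric, ordinaryHypergeometric_sum_eq,
    tsum_eq_sum (s := Finset.range (n + 1)), Finset.mul_sum]
  · refine Finset.sum_congr rfl fun i hi => ?_
    have hi' : i ≤ n := Nat.lt_succ_iff.mp (Finset.mem_range.mp hi)
    change poch (α + 1) n / (n.factorial : ℝ) * (((i.factorial : ℝ)⁻¹ * poch (-(n : ℝ)) i *
      poch (n + α + β + 1) i * (poch (α + 1) i)⁻¹) • ((1 - (1 - 2 * s)) / 2) ^ i) = _
    have h1 := (poch_pos (show 0 < α + 1 by linarith) i).ne'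
    have h2 : (n.factorial : ℝ) ≠ 0 := by positivity
    have h3 : ((n - i).factorial : ℝ) ≠ 0 := by positivity
    have h4 : (i.factorial : ℝ) ≠ 0 := by positivity
    have e := poch_add (α + 1) i (n - i)
    rw [Nat.add_sub_cancel' hi'] at e
    rw [poch_neg_nat hi', e, jacobiCoeff, show (1 - (1 - 2 * s)) / 2 = s by ring, smul_eq_mul]
    field_simp
  · intro i hi
    have hi' : n < i := by simpa using hi
    change ((i.factorial : ℝ)⁻¹ * poch (-(n : ℝ)) i *
      poch (n + α + β + 1) i * (poch (α + 1) i)⁻¹) • ((1 - (1 - 2 * s)) / 2) ^ i = _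
    rw [poch_neg_nat_of_lt hi']; simp

/-- The reflection `P_n^{(α,β)}(-t) = (-1)^n P_n^{(β,α)}(t)` on the level of coefficients: after
expanding `(1-x)^i`, the coefficient of `x^j` is a Chu–Vandermonde sum. -/
lemma sum_jacobiCoeff_one_sub (n : ℕ) (α β x : ℝ) :
    ∑ i ∈ Finset.range (n + 1), jacobiCoeff n α β i * (1 - x) ^ i =
      (-1) ^ n * ∑ i ∈ Finset.range (n + 1), jacobiCoeff n β α i * x ^ i := by
  have h1 : ∀ i ∈ Finset.range (n + 1), jacobiCoeff n α β i * (1 - x) ^ i =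
      ∑ j ∈ Finset.range (n + 1), if j ≤ i then
        jacobiCoeff n α β i * ((-1) ^ j * (i.choose j : ℝ)) * x ^ j else 0 := by
    intro i hi
    have hi' : i + 1 ≤ n + 1 := Finset.mem_range.mp hi
    rw [← Finset.sum_filter, sub_eq_add_neg, add_comm, add_pow, Finset.mul_sum]
    refine (Finset.sum_congr ?_ fun j _ => ?_)
    · ext j; simp; omega
    · rw [neg_pow x]; simp; ring
  rw [Finset.sum_congr rfl h1, Finset.sum_comm, Finset.mul_sum]
  refine Finset.sum_congr rfl fun j hj => ?_
  obtain ⟨r, rfl⟩ := Nat.exists_eq_add_of_le (Nat.lt_succ_iff.mp (Finset.mem_range.mp hj))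
  rw [← Finset.sum_filter]
  have h2 : (Finset.range (j + r + 1)).filter (fun i => j ≤ i) =
      (Finset.range (r + 1)).map (addLeftEmbedding j) := by
    ext i
    simp only [Finset.mem_filter, Finset.mem_range, Finset.mem_map, addLeftEmbedding_apply]
    exact ⟨fun h => ⟨i - j, by omega, by omega⟩, by rintro ⟨k, hk, rfl⟩; omega⟩
  rw [h2, Finset.sum_map]
  have cv := chu_vandermonde r ((j + r : ℕ) + α + β + 1 + j) (α + 1 + j)
  have e1 : poch (α + 1 + j - ((j + r : ℕ) + α + β + 1 + j)) r = (-1) ^ r * poch (β + 1 + j) r := by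
    rw [← poch_neg]; congr 1; push_cast; ring
  rw [e1] at cv
  have hr : (r.factorial : ℝ) ≠ 0 := by positivity
  have hj : (j.factorial : ℝ) ≠ 0 := by positivity
  calc _ = ∑ k ∈ Finset.range (r + 1), poch ((j + r : ℕ) + α + β + 1) j /
        (j.factorial * r.factorial) * x ^ j * ((-1) ^ k * (r.choose k : ℝ) *
        poch ((j + r : ℕ) + α + β + 1 + j) k * poch (α + 1 + j + k) (r - k)) := by
        refine Finset.sum_congr rfl fun k hk => ?_
        obtain ⟨q, rfl⟩ := Nat.exists_eq_add_of_le (Nat.lt_succ_iff.mp (Finset.mem_range.mp hk))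
        have hk0 : (k.factorial : ℝ) ≠ 0 := by positivity
        have hq0 : (q.factorial : ℝ) ≠ 0 := by positivity
        have hjk : ((j + k).factorial : ℝ) ≠ 0 := by positivity
        have c1 : ((j + k).choose j : ℝ) = (j + k).factorial / (j.factorial * k.factorial) := by
          rw [Nat.cast_choose ℝ (Nat.le_add_right j k), Nat.add_sub_cancel_left]
        have c2 : ((k + q).choose k : ℝ) = (k + q).factorial / (k.factorial * q.factorial) := by
          rw [Nat.cast_choose ℝ (Nat.le_add_right k q), Nat.add_sub_cancel_left]
        have s1 : ((-1 : ℝ) ^ j) * (-1) ^ j = 1 := by rw [← mul_pow]; simp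
        rw [addLeftEmbedding_apply, jacobiCoeff, show j + (k + q) - (j + k) = q by omega,
          Nat.add_sub_cancel_left, poch_add, c1, c2, pow_add,
          show α + 1 + ((j + k : ℕ) : ℝ) = α + 1 + j + k by push_cast; ring]
        field_simp
        linear_combination (x ^ j * poch (α + 1 + j + k) q *
          poch ((j + (k + q) : ℕ) + α + β + 1) j *
          poch ((j + (k + q) : ℕ) + α + β + 1 + j) k) * s1
    _ = _ := by
        have s1 : ((-1 : ℝ) ^ j) * (-1) ^ j = 1 := by rw [← mul_pow]; simp
        rw [← Finset.mul_sum, cv, jacobiCoeff, Nat.add_sub_cancel_left,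
          show ((j + r : ℕ) : ℝ) + β + α + 1 = (j + r : ℕ) + α + β + 1 by ring, pow_add]
        field_simp
        linear_combination (-poch ((j + r : ℕ) + α + β + 1) j * x ^ j *
          poch (β + 1 + j) r) * s1

lemma jacobiP_two_mul_sub_one (n : ℕ) {α : ℝ} (hα : -1 < α) (β x : ℝ) :
    jacobiP n α β (2 * x - 1) =
      (-1) ^ n * ∑ i ∈ Finset.range (n + 1), jacobiCoeff n β α i * x ^ i := by
  rw [show 2 * x - 1 = 1 - 2 * (1 - x) by ring, jacobiP_one_sub_two_mul n hα,
    sum_jacobiCoeff_one_sub]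

lemma jacobiP_one (n : ℕ) {α : ℝ} (hα : -1 < α) (β : ℝ) :
    jacobiP n α β 1 = poch (α + 1) n / n.factorial := by
  have h := jacobiP_one_sub_two_mul n hα β 0
  rw [Finset.sum_eq_single 0 (fun i _ hi => by simp [hi]) (by simp)] at h
  simpa [jacobiCoeff] using h

lemma jacobiP_neg_one (n : ℕ) {α : ℝ} (hα : -1 < α) (β : ℝ) :
    jacobiP n α β (-1) = (-1) ^ n * (poch (β + 1) n / n.factorial) := by
  have h := jacobiP_two_mul_sub_one n hα β 0
  rw [Finset.sum_eq_single 0 (fun i _ hi => by simp [hi]) (by simp)] at h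
  simpa [jacobiCoeff] using h

/-- Integrating term by term gives a Chu–Vandermonde sum. The factor `(r+1-n)_n` carries
orthogonality: it vanishes for `r < n` and equals `n!` for `r = n`. -/
lemma betaMean_jacobi_mul_pow (n r : ℕ) {α β : ℝ} (hα : -1 < α) (hβ : -1 < β) :
    betaMean α β (fun t => (∑ i ∈ Finset.range (n + 1), jacobiCoeff n α β i * t ^ i) *
      (1 - t) ^ r) = poch (α + 1) n * poch (β + 1) r / (n.factorial * poch (α + β + 2) (n + r)) *
        poch (r + 1 - n) n := by
  have e1 : (fun t : ℝ => (∑ i ∈ Finset.range (n + 1), jacobiCoeff n α β i * t ^ i) *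
      (1 - t) ^ r) = fun t => ∑ i ∈ Finset.range (n + 1), jacobiCoeff n α β i *
        (t ^ i * (1 - t) ^ r) := by
    funext t; rw [Finset.sum_mul]; exact Finset.sum_congr rfl fun i _ => by ring
  rw [e1, betaMean_sum hα hβ _ _ _ (fun i => by fun_prop)]
  have cv := chu_vandermonde n (n + α + β + 1) (α + β + 2 + r)
  rw [show α + β + 2 + r - (n + α + β + 1) = (r : ℝ) + 1 - n by ring] at cv
  rw [← cv, Finset.mul_sum]
  refine Finset.sum_congr rfl fun i hi => ?_
  obtain ⟨q, rfl⟩ := Nat.exists_eq_add_of_le (Nat.lt_succ_iff.mp (Finset.mem_range.mp hi))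
  rw [betaMean_pow hα hβ, jacobiCoeff, Nat.add_sub_cancel_left,
    Nat.cast_choose ℝ (Nat.le_add_right i q), Nat.add_sub_cancel_left, poch_add _ i q,
    show i + q + r = (i + r) + q by ring, poch_add _ (i + r) q,
    show α + β + 2 + ((i + r : ℕ) : ℝ) = α + β + 2 + r + i by push_cast; ring]
  have h1 := (poch_pos (show 0 < α + β + 2 by linarith) (i + r)).ne'
  have h2 := (poch_pos (show 0 < α + β + 2 + r + i by
    have := i.cast_nonneg (α := ℝ); have := r.cast_nonneg (α := ℝ); linarith) q).ne'
  have h3 : (i.factorial : ℝ) ≠ 0 := by positivity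
  have h4 : (q.factorial : ℝ) ≠ 0 := by positivity
  have h5 : ((i + q).factorial : ℝ) ≠ 0 := by positivity
  field_simp

/-- The square norm of the Jacobi polynomials. -/
lemma betaMean_jacobiP_sq (n : ℕ) {α β : ℝ} (hα : -1 < α) (hβ : -1 < β) (hαβ : -1 < α + β) :
    betaMean α β (fun t => jacobiP n α β (1 - 2 * t) ^ 2) = jacobiH n α β := by
  -- By reflection one of the two factors is expanded in powers of `1 - t`; orthogonality leaves
  -- only the top power `r = n`.
  have e1 : (fun t : ℝ => jacobiP n α β (1 - 2 * t) ^ 2) = fun t =>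
      ∑ r ∈ Finset.range (n + 1), ((-1) ^ n * jacobiCoeff n β α r) *
        ((∑ i ∈ Finset.range (n + 1), jacobiCoeff n α β i * t ^ i) * (1 - t) ^ r) := by
    funext t
    have h2 : jacobiP n α β (1 - 2 * t) = (-1) ^ n *
        ∑ r ∈ Finset.range (n + 1), jacobiCoeff n β α r * (1 - t) ^ r := by
      rw [← jacobiP_two_mul_sub_one n hα]; congr 1; ring
    rw [sq]
    nth_rewrite 1 [h2]
    rw [jacobiP_one_sub_two_mul n hα, Finset.mul_sum (s := Finset.range (n + 1)) (a := (-1) ^ n),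
      Finset.sum_mul]
    exact Finset.sum_congr rfl fun r _ => by ring
  rw [e1, betaMean_sum hα hβ _ _ _ (fun r => by fun_prop), Finset.sum_range_succ,
    Finset.sum_eq_zero, zero_add, betaMean_jacobi_mul_pow n n hα hβ]
  · have s1 : ((-1 : ℝ) ^ n) * (-1) ^ n = 1 := by rw [← mul_pow]; simp
    have p1 := poch_add (α + β + 2) n n
    have hn := n.cast_nonneg (α := ℝ)
    have p2 : poch (n + α + β + 1) n * (α + β + 2 * n + 1) =
        (α + β + n + 1) * poch (α + β + 2 + n) n := by
      have q1 := poch_succ (n + α + β + 1) n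
      rw [poch_succ_left, show (n : ℝ) + α + β + 1 + 1 = α + β + 2 + n by ring] at q1
      linear_combination -q1
    have h1 := (poch_pos (show 0 < α + β + 2 by linarith) n).ne'
    have h2 := (poch_pos (show 0 < α + β + 2 + n by linarith) n).ne'
    have h3 : (n.factorial : ℝ) ≠ 0 := by positivity
    have h4 : α + β + 2 * n + 1 ≠ 0 := by linarith
    rw [jacobiCoeff, jacobiH, p1, Nat.sub_self, show (n : ℝ) + 1 - n = 1 by ring, poch_one,
      show (n : ℝ) + β + α + 1 = n + α + β + 1 by ring, Nat.factorial_zero, poch_zero,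
      Nat.cast_one]
    generalize α + β + 2 * n + 1 = x at *
    generalize poch (n + α + β + 1) n = y at *
    field_simp
    linear_combination (poch (α + 1) n * poch (β + 1) n * y * x) * s1 +
      poch (α + 1) n * poch (β + 1) n * p2
  · intro r hr
    have hr' := Finset.mem_range.mp hr
    rw [betaMean_jacobi_mul_pow n r hα hβ]
    obtain ⟨q, rfl⟩ := Nat.exists_eq_add_of_lt hr'
    rw [show (r : ℝ) + 1 - (r + q + 1 : ℕ) = -(q : ℝ) by push_cast; ring,
      poch_neg_nat_of_lt (by omega)]
    ring

end Jacobi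

/-! ### Gaussian integrals of polynomials and integration by parts. -/

section Gaussian

open MvPolynomial

lemma integrable_pow_mul_gaussian (k : ℕ) :
    Integrable fun x : ℝ => x ^ k * Real.exp (-x ^ 2) := by
  have h := integrable_rpow_mul_exp_neg_mul_sq (b := 1) one_pos (s := (k : ℝ))
    (by have := k.cast_nonneg (α := ℝ); linarith)
  simpa [Real.rpow_natCast] using h

/-- The derivative of `x^k exp(-x²)` has integral zero. At `k = 0` the truncated exponent `k - 1` is
harmless, since its term carries the factor `k`. -/
lemma integral_pow_mul_gaussian (k : ℕ) :
    (k : ℝ) * ∫ x : ℝ, x ^ (k - 1) * Real.exp (-x ^ 2) =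
      2 * ∫ x : ℝ, x ^ (k + 1) * Real.exp (-x ^ 2) := by
  have i1 := (integrable_pow_mul_gaussian (k - 1)).const_mul (k : ℝ)
  have i2 := (integrable_pow_mul_gaussian (k + 1)).const_mul 2
  have h := integral_eq_zero_of_hasDerivAt_of_integrable
    (f := fun x : ℝ => x ^ k * Real.exp (-x ^ 2))
    (f' := fun x : ℝ => k * (x ^ (k - 1) * Real.exp (-x ^ 2)) -
      2 * (x ^ (k + 1) * Real.exp (-x ^ 2)))
    (fun x => by
      have h := (hasDerivAt_pow k x).mul ((hasDerivAt_pow 2 x).neg.exp)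
      refine h.congr_deriv ?_
      simp only [Nat.add_one_sub_one, pow_one, Nat.cast_ofNat, Pi.neg_apply]
      ring) (i1.sub i2) (integrable_pow_mul_gaussian k)
  rw [integral_sub i1 i2, integral_const_mul, integral_const_mul] at h
  linarith

/-- The moments of the Gaussian `exp(-x²)` on the line. -/
noncomputable def gaussMoment (k : ℕ) : ℝ := ∫ x : ℝ, x ^ k * Real.exp (-x ^ 2)

/-- The product of a polynomial and the Gaussian `exp(-‖x‖²)`. -/
noncomputable def polyGauss {d : ℕ} (p : MvPolynomial (Fin d) ℝ)
    (x : EuclideanSpace ℝ (Fin d)) : ℝ :=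
  eval (fun i => x i) p * Real.exp (-‖x‖ ^ 2)

variable {d : ℕ}

lemma polyGauss_monomial (s : Fin d →₀ ℕ) (a : ℝ) (x : Fin d → ℝ) :
    polyGauss (monomial s a) (WithLp.toLp 2 x) = a * ∏ i, x i ^ s i * Real.exp (-(x i) ^ 2) := by
  rw [polyGauss, eval_monomial, Finset.prod_mul_distrib, ← Real.exp_sum,
    EuclideanSpace.real_norm_sq_eq, Finset.sum_neg_distrib,
    Finsupp.prod_fintype _ _ (fun i => pow_zero _), mul_assoc]

lemma integrable_polyGauss (p : MvPolynomial (Fin d) ℝ) : Integrable (polyGauss p) := by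
  induction p using MvPolynomial.induction_on' with
  | monomial s a =>
    rw [← (PiLp.volume_preserving_toLp (Fin d)).integrable_comp_emb
      (MeasurableEquiv.toLp 2 (Fin d → ℝ)).measurableEmbedding]
    have : Integrable fun x : Fin d → ℝ => ∏ i, (x i ^ s i * Real.exp (-(x i) ^ 2)) :=
      Integrable.fintype_prod (f := fun i (y : ℝ) => y ^ s i * Real.exp (-y ^ 2))
        fun i => integrable_pow_mul_gaussian (s i)
    refine (this.const_mul a).congr (Filter.Eventually.of_forall fun x => ?_)
    exact (polyGauss_monomial s a x).symm
  | add p q hp hq =>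
    refine (hp.add hq).congr (Filter.Eventually.of_forall fun x => ?_)
    simp only [polyGauss, map_add, Pi.add_apply]; ring

/-- Integration of a polynomial against the Gaussian `exp(-‖x‖²)`. -/
noncomputable def gaussIntegral (d : ℕ) : MvPolynomial (Fin d) ℝ →ₗ[ℝ] ℝ where
  toFun p := ∫ x, polyGauss p x
  map_add' p q := by
    rw [← integral_add (integrable_polyGauss p) (integrable_polyGauss q)]
    congr 1; funext x; simp only [polyGauss, map_add]; ring
  map_smul' c p := by
    rw [RingHom.id_apply, smul_eq_mul, ← integral_const_mul]
    congr 1; funext x; simp only [polyGauss, smul_eval]; ring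

lemma gaussIntegral_monomial (s : Fin d →₀ ℕ) (a : ℝ) :
    gaussIntegral d (monomial s a) = a * ∏ i, gaussMoment (s i) := by
  change ∫ x, polyGauss (monomial s a) x = _
  rw [← (PiLp.volume_preserving_toLp (Fin d)).integral_comp
    (MeasurableEquiv.toLp 2 (Fin d → ℝ)).measurableEmbedding]
  simp_rw [polyGauss_monomial]
  rw [integral_const_mul]
  exact congrArg _ (integral_fintype_prod_volume_eq_prod
    (fun i (y : ℝ) => y ^ s i * Real.exp (-y ^ 2)))

/-- Integration by parts against the Gaussian. -/
lemma gaussIntegral_pderiv (i : Fin d) (p : MvPolynomial (Fin d) ℝ) :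
    gaussIntegral d (pderiv i p) = 2 * gaussIntegral d (X i * p) := by
  induction p using MvPolynomial.induction_on' with
  | monomial s a =>
    have e : (X i : MvPolynomial (Fin d) ℝ) * monomial s a =
        monomial (s + Finsupp.single i 1) a := by
      rw [X, monomial_mul, one_mul, add_comm]
    rw [pderiv_monomial, e, gaussIntegral_monomial, gaussIntegral_monomial,
      ← Finset.mul_prod_erase _ _ (Finset.mem_univ i), ← Finset.mul_prod_erase _ _
        (Finset.mem_univ i)]
    have h : (s i : ℝ) * gaussMoment (s i - 1) = 2 * gaussMoment (s i + 1) :=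
      integral_pow_mul_gaussian (s i)
    have e1 : ∏ j ∈ Finset.univ.erase i, gaussMoment ((s - Finsupp.single i 1 : Fin d →₀ ℕ) j) =
        ∏ j ∈ Finset.univ.erase i, gaussMoment (s j) :=
      Finset.prod_congr rfl fun j hj => by simp [(Finset.ne_of_mem_erase hj).symm]
    have e2 : ∏ j ∈ Finset.univ.erase i, gaussMoment ((s + Finsupp.single i 1 : Fin d →₀ ℕ) j) =
        ∏ j ∈ Finset.univ.erase i, gaussMoment (s j) :=
      Finset.prod_congr rfl fun j hj => by simp [(Finset.ne_of_mem_erase hj).symm]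
    rw [e1, e2]
    simp only [Finsupp.coe_tsub, Pi.sub_apply, Finsupp.single_eq_same, Finsupp.coe_add,
      Pi.add_apply]
    linear_combination (a * ∏ j ∈ Finset.univ.erase i, gaussMoment (s j)) * h
  | add p q hp hq => rw [map_add, map_add, hp, hq, mul_add, map_add, mul_add]

lemma laplacian_apply (p : MvPolynomial (Fin d) ℝ) :
    laplacian d p = ∑ i, pderiv i (pderiv i p) := by
  simp [laplacian, LinearMap.sum_apply]

/-- Integration by parts turns `Δ` into twice the Euler operator `∑ x_i ∂_i`, which acts on `p` as
multiplication by `k`. -/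
lemma gaussIntegral_laplacian {k : ℕ} {p : MvPolynomial (Fin d) ℝ} (hp : p.IsHomogeneous k) :
    gaussIntegral d (laplacian d p) = 2 * k * gaussIntegral d p := by
  rw [laplacian_apply, map_sum]
  simp_rw [gaussIntegral_pderiv]
  rw [← Finset.mul_sum, ← map_sum, hp.sum_X_mul_pderiv, map_nsmul, nsmul_eq_mul, mul_assoc]

end Gaussian

/-! ### Means over the unit sphere, by polar coordinates. -/

section SphereMean

open MvPolynomial

variable {d : ℕ}

lemma continuous_eval_coord (p : MvPolynomial (Fin d) ℝ) :
    Continuous fun x : EuclideanSpace ℝ (Fin d) => eval (fun i => x i) p :=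
  (MvPolynomial.continuous_eval p).comp (by fun_prop)

lemma integrable_sphere {f : EuclideanSpace ℝ (Fin d) → ℝ} (hf : Continuous f) :
    Integrable (fun ξ : Metric.sphere (0 : EuclideanSpace ℝ (Fin d)) 1 => f ξ)
      ((volume : Measure (EuclideanSpace ℝ (Fin d))).toSphere) :=
  (hf.comp continuous_subtype_val).integrable_of_hasCompactSupport
    (HasCompactSupport.of_compactSpace _)

lemma eval_smul_of_isHomogeneous {k : ℕ} {p : MvPolynomial (Fin d) ℝ} (hp : p.IsHomogeneous k)
    (r : ℝ) (x : Fin d → ℝ) : eval (fun i => r * x i) p = r ^ k * eval x p := by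
  rw [eval_eq, eval_eq, Finset.mul_sum]
  refine Finset.sum_congr rfl fun s hs => ?_
  have := hp (mem_support_iff.mp hs)
  simp_rw [mul_pow]
  rw [Finset.prod_mul_distrib, Finset.prod_pow_eq_pow_sum]
  have e : ∑ i, s i = k := by
    rw [← this, Finsupp.weight_apply, Finsupp.sum_fintype] <;> simp
  rw [← Finsupp.degree_eq_sum] at e
  have e' : ∑ i ∈ s.support, s i = k := by rw [← e]; rfl
  rw [e']; ring

/-- The integral of a polynomial against the Gaussian in polar coordinates. -/
lemma gaussIntegral_eq_sphereIntegral [NeZero d] {k : ℕ} {p : MvPolynomial (Fin d) ℝ}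
    (hp : p.IsHomogeneous k) :
    gaussIntegral d p = sphereIntegral d (fun ξ => eval (fun i => ξ i) p) *
      (Real.Gamma (((k : ℝ) + d) / 2) / 2) := by
  set E := EuclideanSpace ℝ (Fin d)
  set μ : Measure E := volume
  have hfr : Module.finrank ℝ E = d := finrank_euclideanSpace_fin
  have hd : 0 < d := Nat.pos_of_ne_zero (NeZero.ne d)
  have : Nontrivial E := Module.nontrivial_of_finrank_pos (R := ℝ) (by rw [hfr]; exact hd)
  calc
    _ = ∫ x : ({(0)}ᶜ : Set E), polyGauss p x.1 ∂(μ.comap (↑)) := by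
      rw [integral_subtype_comap (measurableSet_singleton _).compl (polyGauss p),
        restrict_compl_singleton]
      rfl
    _ = ∫ z, polyGauss p (z.2.1 • z.1.1)
        ∂μ.toSphere.prod (.volumeIoiPow (Module.finrank ℝ E - 1)) := by
      have h := μ.measurePreserving_homeomorphUnitSphereProd.integral_comp
        (Homeomorph.measurableEmbedding _)
        (fun z : Metric.sphere (0 : E) 1 × Set.Ioi (0 : ℝ) => polyGauss p (z.2.1 • z.1.1))
      rw [← h]
      refine integral_congr_ae (Filter.Eventually.of_forall fun x => ?_)
      have hx : ‖x.1‖ ≠ 0 := norm_ne_zero_iff.mpr x.2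
      simp [smul_smul, hx]
    _ = ∫ z : Metric.sphere (0 : E) 1 × Set.Ioi (0 : ℝ), eval (fun i => z.1.1 i) p *
        (z.2.1 ^ k * Real.exp (-z.2.1 ^ 2))
        ∂μ.toSphere.prod (.volumeIoiPow (Module.finrank ℝ E - 1)) := by
      refine integral_congr_ae (Filter.Eventually.of_forall fun z => ?_)
      have h1 : ‖z.1.1‖ = 1 := by simp
      have h2 : (0 : ℝ) < z.2.1 := z.2.2
      simp only [polyGauss, norm_smul, h1, mul_one, Real.norm_eq_abs, sq_abs]
      have h3 := eval_smul_of_isHomogeneous hp z.2.1 z.1.1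
      change eval (fun i => z.2.1 * z.1.1 i) p * _ = _
      rw [h3]; ring
    _ = sphereIntegral d (fun ξ => eval (fun i => ξ i) p) *
        ∫ r : Set.Ioi (0 : ℝ), r.1 ^ k * Real.exp (-r.1 ^ 2)
          ∂(.volumeIoiPow (Module.finrank ℝ E - 1)) :=
      integral_prod_mul (fun ξ : Metric.sphere (0 : E) 1 => eval (fun i => ξ.1 i) p)
        (fun r : Set.Ioi (0 : ℝ) => r.1 ^ k * Real.exp (-r.1 ^ 2))
    -- The radial factor is the integral of `r^(k+d-1) exp(-r²)`, which is `Γ((k+d)/2)/2`.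
    _ = _ := by
      congr 1
      simp only [Measure.volumeIoiPow, ENNReal.ofReal]
      rw [integral_withDensity_eq_integral_smul,
        integral_subtype_comap measurableSet_Ioi fun a : ℝ =>
          Real.toNNReal (a ^ (Module.finrank ℝ E - 1)) • (a ^ k * Real.exp (-a ^ 2)),
        setIntegral_congr_fun (g := fun x : ℝ => x ^ ((k : ℝ) + d - 1) * Real.exp (-x ^ (2 : ℝ)))
          measurableSet_Ioi fun x hx => ?_, integral_rpow_mul_exp_neg_rpow two_pos]
      · rw [show (k : ℝ) + d - 1 + 1 = k + d by ring]; ring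
      · have : (1 : ℝ) ≤ d := by exact_mod_cast hd
        have := k.cast_nonneg (α := ℝ)
        linarith
      · have hx0 : (0 : ℝ) < x := hx
        simp only
        rw [NNReal.smul_def, Real.coe_toNNReal _ (pow_nonneg hx0.le _), hfr,
          show (k : ℝ) + d - 1 = ((d - 1 + k : ℕ) : ℝ) by push_cast [Nat.cast_sub hd]; ring,
          Real.rpow_natCast, Real.rpow_two, smul_eq_mul, pow_add]
        ring
      · exact (measurable_subtype_coe.pow_const _).real_toNNReal

lemma sphereArea_pos [NeZero d] : 0 < sphereArea d := by
  have hd : (0 : ℝ) < d := by exact_mod_cast Nat.pos_of_ne_zero (NeZero.ne d)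
  exact div_pos (by positivity) (Real.Gamma_pos_of_pos (by linarith))

/-- The mean of a polynomial over the unit sphere. -/
noncomputable def sphereMean (d : ℕ) : MvPolynomial (Fin d) ℝ →ₗ[ℝ] ℝ where
  toFun p := 1 / sphereArea d * sphereIntegral d (fun ξ => eval (fun i => ξ i) p)
  map_add' p q := by
    rw [← mul_add, sphereIntegral, sphereIntegral, sphereIntegral,
      ← integral_add (integrable_sphere (continuous_eval_coord p))
        (integrable_sphere (continuous_eval_coord q))]
    simp only [map_add]
  map_smul' c p := by
    simp only [sphereIntegral, smul_eval, integral_const_mul, RingHom.id_apply, smul_eq_mul]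
    ring

lemma sphereMean_apply (p : MvPolynomial (Fin d) ℝ) : sphereMean d p =
    1 / sphereArea d * sphereIntegral d (fun ξ => eval (fun i => ξ i) p) := rfl

lemma sphereMean_congr {p q : MvPolynomial (Fin d) ℝ}
    (h : ∀ ξ : EuclideanSpace ℝ (Fin d), ‖ξ‖ = 1 → eval (fun i => ξ i) p = eval (fun i => ξ i) q) :
    sphereMean d p = sphereMean d q := by
  rw [sphereMean_apply, sphereMean_apply]
  congr 1
  exact integral_congr_ae (Filter.Eventually.of_forall fun ξ => h ξ (by simp))

lemma gaussIntegral_eq_sphereMean [NeZero d] {k : ℕ} {p : MvPolynomial (Fin d) ℝ}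
    (hp : p.IsHomogeneous k) :
    gaussIntegral d p = sphereMean d p * (sphereArea d * (Real.Gamma (((k : ℝ) + d) / 2) / 2)) := by
  have := (sphereArea_pos (d := d)).ne'
  rw [gaussIntegral_eq_sphereIntegral hp, sphereMean_apply]
  field_simp

/-- Comparing the two evaluations of the Gaussian integral of `1`, in polar and in Cartesian
coordinates, shows that `sphereArea` is the total mass of the surface measure. -/
lemma sphereMean_one [NeZero d] : sphereMean d 1 = 1 := by
  have h := gaussIntegral_eq_sphereMean (d := d) (isHomogeneous_one (Fin d) ℝ)
  have h2 := gaussIntegral_monomial (d := d) 0 1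
  rw [show (monomial 0 1 : MvPolynomial (Fin d) ℝ) = 1 from rfl, h] at h2
  have hg : gaussMoment 0 = Real.sqrt Real.pi := by
    have := integral_gaussian 1
    simpa [gaussMoment] using this
  have hd : (0 : ℝ) < d := by exact_mod_cast Nat.pos_of_ne_zero (NeZero.ne d)
  have hG := (Real.Gamma_pos_of_pos (show 0 < (d : ℝ) / 2 by linarith)).ne'
  have hpi : Real.pi ^ ((d : ℝ) / 2) = Real.sqrt Real.pi ^ d := by
    rw [Real.sqrt_eq_rpow, ← Real.rpow_natCast, ← Real.rpow_mul Real.pi_pos.le]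
    congr 1; ring
  have hs : Real.sqrt Real.pi ^ d ≠ 0 := by positivity
  simp only [Finsupp.coe_zero, Pi.zero_apply, hg, Finset.prod_const, Finset.card_univ,
    Fintype.card_fin, one_mul, sphereArea, hpi, Nat.cast_zero, zero_add] at h2
  field_simp at h2
  exact h2

/-- In polar coordinates `gaussIntegral_laplacian` relates sphere means of `p` and `Δp`; the radial
factors of degrees `k` and `k - 2` differ by `(k+d-2)/2`. -/
lemma sphereMean_laplacian (hd : 2 ≤ d) {k : ℕ} {p : MvPolynomial (Fin d) ℝ}
    (hp : p.IsHomogeneous k) :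
    (k : ℝ) * (k + d - 2) * sphereMean d p = sphereMean d (laplacian d p) := by
  have : NeZero d := ⟨by omega⟩
  have hd' : (2 : ℝ) ≤ d := by exact_mod_cast hd
  have hA := (sphereArea_pos (d := d)).ne'
  have hL : (laplacian d p).IsHomogeneous (k - 2) := by
    rw [laplacian_apply]
    exact IsHomogeneous.sum _ _ _ fun i _ => hp.pderiv.pderiv
  have h := gaussIntegral_laplacian hp
  rw [gaussIntegral_eq_sphereMean hp] at h
  have hk0 := k.cast_nonneg (α := ℝ)
  have hG := (Real.Gamma_pos_of_pos (show 0 < ((k : ℝ) + d) / 2 by linarith)).ne'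
  by_cases hk : 2 ≤ k
  · obtain ⟨j, rfl⟩ := Nat.exists_eq_add_of_le' hk
    have hj0 := j.cast_nonneg (α := ℝ)
    have hG' := (Real.Gamma_pos_of_pos (show 0 < ((j : ℝ) + d) / 2 by linarith)).ne'
    rw [Nat.add_sub_cancel] at hL
    rw [gaussIntegral_eq_sphereMean hL,
      show (((j + 2 : ℕ) : ℝ) + d) / 2 = (j + d) / 2 + 1 by push_cast; ring,
      Real.Gamma_add_one (by positivity)] at h
    push_cast at h ⊢
    apply mul_right_cancel₀ (mul_ne_zero hA hG')
    linear_combination -2 * h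
  -- For `k ≤ 1` the first derivatives are constants, so `Δp = 0` and the truncated degree `k - 2`
  -- plays no role.
  · have h0 : laplacian d p = 0 := by
      rw [laplacian_apply]
      refine Finset.sum_eq_zero fun i _ => ?_
      have h1 : (pderiv i p).IsHomogeneous 0 := by
        have := hp.pderiv (i := i)
        rwa [show k - 1 = 0 by omega] at this
      rw [← totalDegree_zero_iff_isHomogeneous, totalDegree_eq_zero_iff_eq_C] at h1
      rw [h1, pderiv_C]
    rw [h0, map_zero] at h ⊢
    have h2 : (k : ℝ) * sphereMean d p = 0 := by
      have : Real.Gamma (((k : ℝ) + d) / 2) * sphereArea d ≠ 0 := mul_ne_zero hG hA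
      apply mul_right_cancel₀ this
      linear_combination -h
    linear_combination ((k : ℝ) + d - 2) * h2

end SphereMean

/-! ### Harmonic polynomials, orthogonality and reproduction by linear forms. -/

section Harmonic

open MvPolynomial

variable {d : ℕ}

/-- The commutator of two derivations is a derivation, and this one kills every variable. -/
lemma pderiv_comm (i j : Fin d) (p : MvPolynomial (Fin d) ℝ) :
    pderiv i (pderiv j p) = pderiv j (pderiv i p) := by
  have h : ⁅(pderiv i : Derivation ℝ (MvPolynomial (Fin d) ℝ) (MvPolynomial (Fin d) ℝ)),
      (pderiv j : Derivation ℝ (MvPolynomial (Fin d) ℝ) (MvPolynomial (Fin d) ℝ))⁆ = 0 := by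
    refine MvPolynomial.derivation_ext fun k => ?_
    rw [Derivation.commutator_apply, pderiv_X, pderiv_X]
    simp [Pi.single_apply, apply_ite]
  have := DFunLike.congr_fun h p
  rw [Derivation.commutator_apply] at this
  simpa [sub_eq_zero] using this

lemma mem_harmonicSpace {m : ℕ} {p : MvPolynomial (Fin d) ℝ} :
    p ∈ harmonicSpace d m ↔ p.IsHomogeneous m ∧ laplacian d p = 0 := by
  simp [harmonicSpace, Submodule.mem_inf, mem_homogeneousSubmodule]

lemma pderiv_mem_harmonicSpace {m : ℕ} {p : MvPolynomial (Fin d) ℝ} (hp : p ∈ harmonicSpace d m)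
    (i : Fin d) : pderiv i p ∈ harmonicSpace d (m - 1) := by
  rw [mem_harmonicSpace] at hp ⊢
  refine ⟨hp.1.pderiv, ?_⟩
  rw [laplacian_apply]
  simp_rw [pderiv_comm _ i]
  rw [← map_sum, ← laplacian_apply, hp.2, map_zero]

lemma eq_C_of_mem_harmonicSpace_zero {p : MvPolynomial (Fin d) ℝ} (hp : p ∈ harmonicSpace d 0) :
    ∃ c, p = C c := by
  have h := (mem_harmonicSpace.mp hp).1
  rw [← totalDegree_zero_iff_isHomogeneous, totalDegree_eq_zero_iff_eq_C] at h
  exact ⟨_, h⟩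

lemma laplacian_mul (p q : MvPolynomial (Fin d) ℝ) :
    laplacian d (p * q) = laplacian d p * q + 2 * ∑ i, pderiv i p * pderiv i q +
      p * laplacian d q := by
  simp only [laplacian_apply, Finset.sum_mul, Finset.mul_sum, ← Finset.sum_add_distrib]
  refine Finset.sum_congr rfl fun i _ => ?_
  simp only [Derivation.leibniz, map_add, smul_eq_mul]
  ring

/-- Harmonic homogeneous polynomials of different degrees are orthogonal on the sphere. -/
lemma sphereMean_mul_eq_zero (hd : 2 ≤ d) {m n : ℕ} (hmn : m ≠ n) {p q : MvPolynomial (Fin d) ℝ}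
    (hp : p ∈ harmonicSpace d m) (hq : q ∈ harmonicSpace d n) : sphereMean d (p * q) = 0 := by
  induction m generalizing n p q with
  | zero =>
    obtain ⟨c, rfl⟩ := eq_C_of_mem_harmonicSpace_zero hp
    have hq' := mem_harmonicSpace.mp hq
    have h := sphereMean_laplacian hd hq'.1
    have hn : (1 : ℝ) ≤ n := by exact_mod_cast Nat.one_le_iff_ne_zero.mpr hmn.symm
    have hd' : (2 : ℝ) ≤ d := by exact_mod_cast hd
    rw [hq'.2, map_zero, mul_eq_zero] at h
    have : (n : ℝ) * (n + d - 2) ≠ 0 := mul_ne_zero (by linarith) (by linarith)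
    rw [C_mul', map_smul, h.resolve_left this, smul_zero]
  | succ m ih =>
    have hp' := mem_harmonicSpace.mp hp
    have hq' := mem_harmonicSpace.mp hq
    have h := sphereMean_laplacian hd (hp'.1.mul hq'.1)
    have hn := n.cast_nonneg (α := ℝ)
    have hm := m.cast_nonneg (α := ℝ)
    have hd' : (2 : ℝ) ≤ d := by exact_mod_cast hd
    -- Since `Δ(pq) = 2 ∑ ∂_i p ∂_i q`, the recursion for means lowers both degrees by one. For `n =
    -- 0` the derivatives of `q` vanish, so the truncated `n - 1` is never used.
    have h0 : ∀ i, sphereMean d (pderiv i p * pderiv i q) = 0 := fun i => by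
      rcases Nat.eq_zero_or_pos n with rfl | hn
      · obtain ⟨c, rfl⟩ := eq_C_of_mem_harmonicSpace_zero hq
        rw [pderiv_C, mul_zero, map_zero]
      · exact ih (n := n - 1) (by omega) (pderiv_mem_harmonicSpace hp i)
          (pderiv_mem_harmonicSpace hq i)
    rw [laplacian_mul, hp'.2, hq'.2, zero_mul, mul_zero, zero_add, add_zero, two_mul, map_add,
      map_sum, Finset.sum_eq_zero fun i _ => h0 i, add_zero, mul_eq_zero] at h
    push_cast at h
    exact h.resolve_left (mul_ne_zero (by linarith) (by linarith))

/-- The linear form `⟨x, ·⟩`. -/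
noncomputable def linForm (x : EuclideanSpace ℝ (Fin d)) : MvPolynomial (Fin d) ℝ :=
  ∑ i, C (x i) * X i

lemma linForm_add (x y : EuclideanSpace ℝ (Fin d)) : linForm (x + y) = linForm x + linForm y := by
  simp only [linForm, PiLp.add_apply, C_add, add_mul, Finset.sum_add_distrib]

lemma isHomogeneous_linForm (x : EuclideanSpace ℝ (Fin d)) : (linForm x).IsHomogeneous 1 :=
  IsHomogeneous.sum _ _ _ fun i _ => (isHomogeneous_X ℝ i).C_mul _

lemma pderiv_linForm (x : EuclideanSpace ℝ (Fin d)) (i : Fin d) :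
    pderiv i (linForm x) = C (x i) := by
  rw [linForm, map_sum, Finset.sum_eq_single i]
  · simp
  · intro j _ hj; simp [pderiv_X_of_ne hj]
  · simp

/-- The directional derivative along `x`. -/
noncomputable def dirDeriv (x : EuclideanSpace ℝ (Fin d)) (p : MvPolynomial (Fin d) ℝ) :
    MvPolynomial (Fin d) ℝ :=
  ∑ i, C (x i) * pderiv i p

lemma dirDeriv_mem_harmonicSpace {m : ℕ} {p : MvPolynomial (Fin d) ℝ}
    (hp : p ∈ harmonicSpace d m) (x : EuclideanSpace ℝ (Fin d)) :
    dirDeriv x p ∈ harmonicSpace d (m - 1) :=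
  Submodule.sum_mem _ fun i _ => by
    rw [C_mul']; exact Submodule.smul_mem _ _ (pderiv_mem_harmonicSpace hp i)

lemma eval_dirDeriv_self {m : ℕ} {p : MvPolynomial (Fin d) ℝ} (hp : p.IsHomogeneous m)
    (x : EuclideanSpace ℝ (Fin d)) :
    eval (fun i => x i) (dirDeriv x p) = m * eval (fun i => x i) p := by
  have h := congrArg (eval (fun i => x i)) hp.sum_X_mul_pderiv
  simpa [dirDeriv, map_sum] using h

/-- The truncated exponents `r - 1` and `r - 2` are harmless: where truncation occurs, the
coefficients `r` and `r(r-1)` vanish. -/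
lemma laplacian_linForm_pow_mul (x : EuclideanSpace ℝ (Fin d)) (r : ℕ)
    {p : MvPolynomial (Fin d) ℝ} (hp : laplacian d p = 0) :
    laplacian d (linForm x ^ r * p) =
      C ((r : ℝ) * (r - 1) * ‖x‖ ^ 2) * (linForm x ^ (r - 2) * p) +
        C (2 * (r : ℝ)) * (linForm x ^ (r - 1) * dirDeriv x p) := by
  have h1 : ∀ (k : ℕ) (i : Fin d), pderiv i (linForm x ^ k) =
      C ((k : ℝ) * x i) * linForm x ^ (k - 1) := fun k i => by
    rw [Derivation.leibniz_pow, pderiv_linForm]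
    simp only [nsmul_eq_mul, smul_eq_mul, C_mul, map_natCast]; ring
  have h2 : laplacian d (linForm x ^ r) =
      C ((r : ℝ) * (r - 1) * ‖x‖ ^ 2) * linForm x ^ (r - 2) := by
    rw [laplacian_apply, EuclideanSpace.real_norm_sq_eq, Finset.mul_sum, map_sum, Finset.sum_mul]
    refine Finset.sum_congr rfl fun i _ => ?_
    rw [h1, C_mul', (pderiv i).map_smul, h1, ← C_mul', ← mul_assoc, ← C_mul, Nat.sub_sub]
    congr 2
    rcases r with _ | r
    · simp
    · push_cast; simp; ring
  rw [laplacian_mul, hp, h2, mul_zero, add_zero, dirDeriv, mul_assoc]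
  congr 1
  rw [Finset.mul_sum, Finset.mul_sum, Finset.mul_sum]
  refine Finset.sum_congr rfl fun i _ => ?_
  rw [h1]
  simp only [C_mul, map_ofNat, map_natCast]; ring

/-- The recursion for means leads from `(r, k)` to `(r-2, k)` and `(r-1, k-1)`, and both keep the
exponent below the degree. -/
lemma sphereMean_linForm_pow_mul_eq_zero (hd : 2 ≤ d) (x : EuclideanSpace ℝ (Fin d)) {r k : ℕ}
    (hrk : r < k) {p : MvPolynomial (Fin d) ℝ} (hp : p ∈ harmonicSpace d k) :
    sphereMean d (linForm x ^ r * p) = 0 := by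
  induction r using Nat.strong_induction_on generalizing k p with
  | _ r ih =>
    have hp' := mem_harmonicSpace.mp hp
    have h := sphereMean_laplacian hd (((isHomogeneous_linForm x).pow r).mul hp'.1)
    rw [laplacian_linForm_pow_mul x r hp'.2, map_add, C_mul', C_mul', map_smul, map_smul] at h
    have h1 : (r : ℝ) * (r - 1) * ‖x‖ ^ 2 * sphereMean d (linForm x ^ (r - 2) * p) = 0 := by
      rcases Nat.lt_or_ge r 2 with hr | hr
      · interval_cases r <;> simp
      · rw [ih (r - 2) (by omega) (by omega) hp, mul_zero]
    have h2 : 2 * (r : ℝ) * sphereMean d (linForm x ^ (r - 1) * dirDeriv x p) = 0 := by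
      rcases Nat.eq_zero_or_pos r with rfl | hr
      · simp
      · rw [ih (r - 1) (by omega) (k := k - 1) (by omega) (dirDeriv_mem_harmonicSpace hp x),
          mul_zero]
    rw [smul_eq_mul, smul_eq_mul, h1, h2, add_zero, mul_eq_zero] at h
    have hk : (1 : ℝ) ≤ k := by exact_mod_cast (show 1 ≤ k by omega)
    have hr := r.cast_nonneg (α := ℝ)
    have hd' : (2 : ℝ) ≤ d := by exact_mod_cast hd
    push_cast at h
    exact h.resolve_left (mul_ne_zero (by linarith) (by linarith))

/-- The reproducing property of the powers of linear forms. -/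
lemma sphereMean_linForm_pow_mul (hd : 2 ≤ d) (x : EuclideanSpace ℝ (Fin d)) {k : ℕ}
    {p : MvPolynomial (Fin d) ℝ} (hp : p ∈ harmonicSpace d k) :
    sphereMean d (linForm x ^ k * p) =
      k.factorial / (2 ^ k * poch ((d : ℝ) / 2) k) * eval (fun i => x i) p := by
  have : NeZero d := ⟨by omega⟩
  induction k generalizing p with
  | zero =>
    obtain ⟨c, rfl⟩ := eq_C_of_mem_harmonicSpace_zero hp
    have h : (C c : MvPolynomial (Fin d) ℝ) = c • 1 := by rw [smul_eq_C_mul, mul_one]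
    rw [pow_zero, one_mul, eval_C, h, map_smul, sphereMean_one]; simp
  | succ k ih =>
    have hp' := mem_harmonicSpace.mp hp
    have h := sphereMean_laplacian hd (((isHomogeneous_linForm x).pow (k + 1)).mul hp'.1)
    -- Only the term with `dirDeriv x p` survives; it is harmonic of degree `k`, and Euler's
    -- identity gives its value `(k+1) p(x)` at `x`.
    have hz : sphereMean d (linForm x ^ (k + 1 - 2) * p) = 0 :=
      sphereMean_linForm_pow_mul_eq_zero hd x (by omega) hp
    rw [laplacian_linForm_pow_mul x _ hp'.2, map_add, C_mul', C_mul', map_smul, map_smul, hz,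
      smul_zero, zero_add, Nat.add_sub_cancel, ih (dirDeriv_mem_harmonicSpace hp x),
      eval_dirDeriv_self hp'.1, smul_eq_mul] at h
    have hd' : (2 : ℝ) ≤ d := by exact_mod_cast hd
    have hk := k.cast_nonneg (α := ℝ)
    have hpk := (poch_pos (show 0 < (d : ℝ) / 2 by linarith) k).ne'
    have hdk : (d : ℝ) / 2 + k ≠ 0 := by linarith
    have hk1 : (k : ℝ) + 1 ≠ 0 := by linarith
    generalize sphereMean d (linForm x ^ (k + 1) * p) = u at h ⊢
    rw [Nat.factorial_succ, pow_succ, poch_succ]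
    push_cast at h ⊢
    generalize poch ((d : ℝ) / 2) k = t at h hpk ⊢
    have e : ((1 * (k + 1) : ℝ) + (k + 1)) * (1 * (k + 1) + (k + 1) + d - 2) =
        4 * (k + 1) * (d / 2 + k) := by ring
    rw [e] at h
    field_simp at h ⊢
    linear_combination (1 / 4 : ℝ) * h

end Harmonic

/-! ### Zonal harmonics and the expansion of `‖x + y‖^(2j)`. -/

section Zonal

open MvPolynomial

variable {d : ℕ}

/-- The polynomial `‖·‖²`. -/
noncomputable def normSqPoly (d : ℕ) : MvPolynomial (Fin d) ℝ := ∑ i, X i ^ 2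

lemma eval_normSqPoly (x : EuclideanSpace ℝ (Fin d)) :
    eval (fun i => x i) (normSqPoly d) = ‖x‖ ^ 2 := by
  simp [normSqPoly, EuclideanSpace.real_norm_sq_eq]

lemma isHomogeneous_normSqPoly : (normSqPoly d).IsHomogeneous 2 :=
  IsHomogeneous.sum _ _ _ fun i _ => isHomogeneous_X_pow i 2

lemma pderiv_normSqPoly (i : Fin d) : pderiv i (normSqPoly d) = 2 * X i := by
  rw [normSqPoly, map_sum, Finset.sum_eq_single i]
  · rw [Derivation.leibniz_pow, pderiv_X_self]; simp
  · intro j _ hj; rw [Derivation.leibniz_pow, pderiv_X_of_ne hj]; simp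
  · simp

lemma laplacian_normSqPoly_mul {k : ℕ} {q : MvPolynomial (Fin d) ℝ} (hq : q.IsHomogeneous k) :
    laplacian d (normSqPoly d * q) =
      C (2 * (d : ℝ) + 4 * k) * q + normSqPoly d * laplacian d q := by
  have h1 : laplacian d (normSqPoly d) = C (2 * (d : ℝ)) := by
    rw [laplacian_apply]
    have : ∀ i : Fin d, pderiv i (pderiv i (normSqPoly d)) = (2 : MvPolynomial (Fin d) ℝ) :=
      fun i => by
        rw [pderiv_normSqPoly, show (2 : MvPolynomial (Fin d) ℝ) = C 2 from (map_ofNat C 2).symm,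
          pderiv_C_mul, pderiv_X_self]; simp
    simp only [this, Finset.sum_const, Finset.card_univ, Fintype.card_fin, nsmul_eq_mul, C_mul,
      map_natCast, map_ofNat]
    ring
  have h2 : ∑ i, pderiv i (normSqPoly d) * pderiv i q = C (2 * (k : ℝ)) * q := by
    simp only [pderiv_normSqPoly, mul_assoc]
    rw [← Finset.mul_sum, hq.sum_X_mul_pderiv, nsmul_eq_mul]
    simp only [C_mul, map_natCast, map_ofNat]; ring
  rw [laplacian_mul, h1, h2]
  simp only [C_mul, C_add, map_natCast, map_ofNat]; ring

/-- Each further factor `‖·‖²` adds `2d + 4(2i+m)`, and these increments sum to the stated constant.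
-/
lemma laplacian_normSqPoly_pow_mul {m : ℕ} {p : MvPolynomial (Fin d) ℝ}
    (hp : p ∈ harmonicSpace d m) (i : ℕ) :
    laplacian d (normSqPoly d ^ i * p) =
      C (4 * (i : ℝ) * (i + m + (d : ℝ) / 2 - 1)) * (normSqPoly d ^ (i - 1) * p) := by
  have hp' := mem_harmonicSpace.mp hp
  induction i with
  | zero => simp [hp'.2]
  | succ i ih =>
    rw [pow_succ', mul_assoc,
      laplacian_normSqPoly_mul ((isHomogeneous_normSqPoly.pow i).mul hp'.1), ih, Nat.add_sub_cancel]
    have e : normSqPoly d * (C (4 * (i : ℝ) * (i + m + (d : ℝ) / 2 - 1)) *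
        (normSqPoly d ^ (i - 1) * p)) =
        C (4 * (i : ℝ) * (i + m + (d : ℝ) / 2 - 1)) * (normSqPoly d ^ i * p) := by
      rcases i with _ | i
      · simp
      · rw [Nat.add_sub_cancel, pow_succ]; ring
    rw [e, ← add_mul, ← C_add]
    congr 2
    push_cast; ring

variable (Y : HarmonicBasis d)

/-- The zonal harmonic `∑_ℓ Y_ℓ^m(x) Y_ℓ^m`. -/
noncomputable def zonal (m : ℕ) (x : EuclideanSpace ℝ (Fin d)) : MvPolynomial (Fin d) ℝ :=
  ∑ l, C (Y.val m l x) * (Y m l : MvPolynomial (Fin d) ℝ)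

/-- The reproducing kernel `∑_ℓ Y_ℓ^m(x) Y_ℓ^m(y)` of the harmonic polynomials. -/
noncomputable def zonalKernel (m : ℕ) (x y : EuclideanSpace ℝ (Fin d)) : ℝ :=
  ∑ l, Y.val m l x * Y.val m l y

lemma zonal_mem (m : ℕ) (x : EuclideanSpace ℝ (Fin d)) : zonal Y m x ∈ harmonicSpace d m :=
  Submodule.sum_mem _ fun l _ => by
    rw [C_mul']; exact Submodule.smul_mem _ _ (Y m l).2

variable {Y}

lemma HarmonicBasis.IsOrthonormal.sphereMean_mul (hY : Y.IsOrthonormal) (m : ℕ)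
    (l l' : Fin (Module.finrank ℝ (harmonicSpace d m))) :
    sphereMean d ((Y m l : MvPolynomial (Fin d) ℝ) * (Y m l' : MvPolynomial (Fin d) ℝ)) =
      if l = l' then 1 else 0 := by
  rw [← hY m l l', sphereMean_apply]
  simp only [map_mul]; rfl

lemma sphereMean_zonal_mul (hY : Y.IsOrthonormal) (m : ℕ) (x : EuclideanSpace ℝ (Fin d))
    (l : Fin (Module.finrank ℝ (harmonicSpace d m))) :
    sphereMean d (zonal Y m x * (Y m l : MvPolynomial (Fin d) ℝ)) = Y.val m l x := by
  rw [zonal, Finset.sum_mul, map_sum, Finset.sum_eq_single l]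
  · rw [mul_assoc, C_mul', map_smul, hY.sphereMean_mul]; simp
  · intro l' _ hl; rw [mul_assoc, C_mul', map_smul, hY.sphereMean_mul]; simp [hl]
  · simp

lemma sphereMean_zonal_mul_zonal (hY : Y.IsOrthonormal) (m : ℕ)
    (x y : EuclideanSpace ℝ (Fin d)) :
    sphereMean d (zonal Y m x * zonal Y m y) = zonalKernel Y m x y := by
  conv_lhs => rw [zonal.eq_def Y m y]
  rw [Finset.mul_sum, map_sum, zonalKernel]
  refine Finset.sum_congr rfl fun l _ => ?_
  rw [mul_left_comm, C_mul', map_smul, sphereMean_zonal_mul hY, smul_eq_mul, mul_comm]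

lemma eq_zero_of_sphereMean_mul_eq_zero (hY : Y.IsOrthonormal) {m : ℕ}
    {p : MvPolynomial (Fin d) ℝ} (hp : p ∈ harmonicSpace d m)
    (h : ∀ l, sphereMean d (p * (Y m l : MvPolynomial (Fin d) ℝ)) = 0) : p = 0 := by
  have e : p = ∑ l, C ((Y m).repr ⟨p, hp⟩ l) * (Y m l : MvPolynomial (Fin d) ℝ) := by
    have := congrArg Subtype.val ((Y m).sum_repr ⟨p, hp⟩)
    rw [Submodule.coe_sum] at this
    simpa [smul_eq_C_mul] using this.symm
  have h0 : ∀ l, (Y m).repr ⟨p, hp⟩ l = 0 := fun l => by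
    rw [← h l]
    conv_rhs => rw [e]
    rw [Finset.sum_mul, map_sum, Finset.sum_eq_single l]
    · rw [mul_assoc, C_mul', map_smul, hY.sphereMean_mul]; simp
    · intro l' _ hl; rw [mul_assoc, C_mul', map_smul, hY.sphereMean_mul]; simp [hl]
    · simp
  rw [e]
  exact Finset.sum_eq_zero fun l _ => by rw [h0, C_0, zero_mul]

lemma sphereMean_normSqPoly_pow_mul (i : ℕ) (p : MvPolynomial (Fin d) ℝ) :
    sphereMean d (normSqPoly d ^ i * p) = sphereMean d p :=
  sphereMean_congr fun ξ hξ => by rw [map_mul, map_pow, eval_normSqPoly, hξ]; simp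

/-- The coefficients of the expansion of powers of linear forms in zonal harmonics. -/
noncomputable def linFormCoeff (d k i : ℕ) : ℝ :=
  k.factorial / (2 ^ k * i.factorial * poch ((d : ℝ) / 2) (k - i))

/-- The part with index `i` of the expansion of `⟨x, ·⟩^k` in zonal harmonics. -/
noncomputable def linFormPart (Y : HarmonicBasis d) (x : EuclideanSpace ℝ (Fin d)) (k i : ℕ) :
    MvPolynomial (Fin d) ℝ :=
  C (linFormCoeff d k i * ‖x‖ ^ (2 * i)) * (normSqPoly d ^ i * zonal Y (k - 2 * i) x)

lemma isHomogeneous_linFormPart (x : EuclideanSpace ℝ (Fin d)) {k i : ℕ} (hi : 2 * i ≤ k) :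
    (linFormPart Y x k i).IsHomogeneous k := by
  have h := ((isHomogeneous_normSqPoly (d := d)).pow i).mul
    (mem_harmonicSpace.mp (zonal_mem Y (k - 2 * i) x)).1
  rw [Nat.add_sub_cancel' hi] at h
  exact h.C_mul _

/-- This mirrors `Δ⟨x,·⟩^(k+2) = (k+2)(k+1)‖x‖² ⟨x,·⟩^k` part by part, and explains the dependence
of `linFormCoeff` on `i`. -/
lemma laplacian_linFormPart_succ (hd : 2 ≤ d) (x : EuclideanSpace ℝ (Fin d)) {k i : ℕ}
    (hi : 2 * i ≤ k) :
    laplacian d (linFormPart Y x (k + 2) (i + 1)) =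
      C (((k : ℝ) + 2) * (k + 1) * ‖x‖ ^ 2) * linFormPart Y x k i := by
  rw [linFormPart, C_mul', map_smul, laplacian_normSqPoly_pow_mul (zonal_mem Y _ x),
    ← C_mul', linFormPart, ← mul_assoc (C _) (C _), ← mul_assoc (C _) (C _), ← C_mul, ← C_mul,
    Nat.add_sub_cancel,
    show k + 2 - 2 * (i + 1) = k - 2 * i by omega]
  congr 2
  obtain ⟨m, rfl⟩ := Nat.exists_eq_add_of_le hi
  have hd' : (2 : ℝ) ≤ d := by exact_mod_cast hd
  rw [linFormCoeff, linFormCoeff, show 2 * i + m + 2 - (i + 1) = i + m + 1 by omega,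
    show 2 * i + m - i = i + m by omega, Nat.add_sub_cancel_left, poch_succ,
    show 2 * i + m + 2 = (2 * i + m + 1) + 1 by ring, Nat.factorial_succ (2 * i + m + 1),
    Nat.factorial_succ (2 * i + m), Nat.factorial_succ i, mul_add 2 i 1, pow_add _ (2 * i) (2 * 1)]
  have h1 := (poch_pos (show 0 < (d : ℝ) / 2 by linarith) (i + m)).ne'
  have h2 : (d : ℝ) / 2 + (i + m : ℕ) ≠ 0 := by positivity
  have h3 : (i.factorial : ℝ) ≠ 0 := by positivity
  generalize poch ((d : ℝ) / 2) (i + m) = t at *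
  have e : ((i + 1 : ℕ) : ℝ) + m + d / 2 - 1 = d / 2 + (i + m : ℕ) := by push_cast; ring
  rw [e]
  generalize (d : ℝ) / 2 + (i + m : ℕ) = u at *
  push_cast
  field_simp
  ring

/-- The expansion of the powers of a linear form in zonal harmonics. -/
lemma linForm_pow_eq_sum (hd : 2 ≤ d) (hY : Y.IsOrthonormal) (x : EuclideanSpace ℝ (Fin d))
    (k : ℕ) :
    linForm x ^ k = ∑ i ∈ Finset.range (k / 2 + 1), linFormPart Y x k i := by
  induction k using Nat.strong_induction_on with
  | _ k ih =>
    -- By induction both sides have the same Laplacian, so their difference is harmonic of degree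
    -- `k`. It vanishes once all its pairings with `Y_ℓ^k` do; in the sum only the part `i = 0`
    -- contributes to these.
    have hL : laplacian d (linForm x ^ k) =
        laplacian d (∑ i ∈ Finset.range (k / 2 + 1), linFormPart Y x k i) := by
      have h0 : laplacian d (linFormPart Y x k 0) = 0 := by
        rw [linFormPart, C_mul', map_smul, laplacian_normSqPoly_pow_mul (zonal_mem Y _ x)]; simp
      have h1 := laplacian_linForm_pow_mul x k (p := 1) (by simp [laplacian_apply])
      have h2 : dirDeriv x 1 = 0 := by simp [dirDeriv]
      rw [mul_one, mul_one, h2, mul_zero, mul_zero, add_zero] at h1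
      rw [h1, map_sum, Finset.sum_range_succ', h0, add_zero]
      rcases Nat.lt_or_ge k 2 with hk | hk
      · interval_cases k <;> simp
      · obtain ⟨j, rfl⟩ := Nat.exists_eq_add_of_le' hk
        rw [Nat.add_sub_cancel, ih j (by omega), show (j + 2) / 2 = j / 2 + 1 by omega,
          Finset.mul_sum]
        refine Finset.sum_congr rfl fun i hi => ?_
        have hi' := Finset.mem_range.mp hi
        rw [laplacian_linFormPart_succ hd x (by omega)]
        congr 2
        push_cast; ring
    rw [← sub_eq_zero]
    refine eq_zero_of_sphereMean_mul_eq_zero hY (m := k) (mem_harmonicSpace.mpr ⟨?_, ?_⟩)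
      fun l => ?_
    · refine IsHomogeneous.sub ?_ ?_
      · simpa using (isHomogeneous_linForm x).pow k
      · exact IsHomogeneous.sum _ _ _ fun i hi =>
          isHomogeneous_linFormPart x (by have := Finset.mem_range.mp hi; omega)
    · rw [map_sub, hL, sub_self]
    · rw [sub_mul, map_sub, sphereMean_linForm_pow_mul hd x (Y k l).2, Finset.sum_mul, map_sum,
        Finset.sum_eq_single 0, sub_eq_zero]
      · rw [linFormPart, mul_zero, Nat.sub_zero, pow_zero (normSqPoly d), one_mul, mul_assoc, C_mul',
          map_smul, sphereMean_zonal_mul hY]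
        simp [linFormCoeff, HarmonicBasis.val]
      · intro i hi hi0
        have := Finset.mem_range.mp hi
        rw [linFormPart, mul_assoc, C_mul', map_smul, mul_assoc, sphereMean_normSqPoly_pow_mul,
          sphereMean_mul_eq_zero hd (by omega) (zonal_mem Y _ x) (Y k l).2, smul_zero]
      · simp

lemma sphereMean_linFormPart_mul (hd : 2 ≤ d) (hY : Y.IsOrthonormal)
    (x y : EuclideanSpace ℝ (Fin d)) (k k' i i' : ℕ) :
    sphereMean d (linFormPart Y x k i * linFormPart Y y k' i') =
      if k - 2 * i = k' - 2 * i' then linFormCoeff d k i * linFormCoeff d k' i' *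
        ‖x‖ ^ (2 * i) * ‖y‖ ^ (2 * i') * zonalKernel Y (k - 2 * i) x y else 0 := by
  have e : linFormPart Y x k i * linFormPart Y y k' i' =
      C (linFormCoeff d k i * linFormCoeff d k' i' * ‖x‖ ^ (2 * i) * ‖y‖ ^ (2 * i')) *
        (normSqPoly d ^ (i + i') * (zonal Y (k - 2 * i) x * zonal Y (k' - 2 * i') y)) := by
    simp only [linFormPart, C_mul, pow_add]; ring
  rw [e, C_mul', map_smul, sphereMean_normSqPoly_pow_mul, smul_eq_mul]
  split_ifs with h
  · rw [← h, sphereMean_zonal_mul_zonal hY]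
  · rw [sphereMean_mul_eq_zero hd h (zonal_mem Y _ x) (zonal_mem Y _ y), mul_zero]

/-- This turns `‖x‖^(2j)` into a sphere mean, to which the binomial theorem applies when `x` is a
sum. -/
lemma sphereMean_linForm_pow (hd : 2 ≤ d) (x : EuclideanSpace ℝ (Fin d)) (j : ℕ) :
    sphereMean d (linForm x ^ (2 * j)) =
      (2 * j).factorial / (4 ^ j * j.factorial * poch ((d : ℝ) / 2) j) * ‖x‖ ^ (2 * j) := by
  have : NeZero d := ⟨by omega⟩
  induction j with
  | zero => simp [sphereMean_one]
  | succ j ih =>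
    have h := sphereMean_laplacian hd ((isHomogeneous_linForm x).pow (2 * (j + 1)))
    have h1 := laplacian_linForm_pow_mul x (2 * (j + 1)) (p := 1) (by simp [laplacian_apply])
    have h2 : dirDeriv x 1 = 0 := by simp [dirDeriv]
    rw [mul_one, mul_one, h2, mul_zero, mul_zero, add_zero] at h1
    rw [h1, show 2 * (j + 1) - 2 = 2 * j by omega, C_mul', map_smul, ih, smul_eq_mul] at h
    generalize sphereMean d (linForm x ^ (2 * (j + 1))) = u at h ⊢
    have hd' : (2 : ℝ) ≤ d := by exact_mod_cast hd
    have hp := (poch_pos (show 0 < (d : ℝ) / 2 by linarith) j).ne'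
    have hdk : (d : ℝ) / 2 + j ≠ 0 := by positivity
    have hj : (j : ℝ) + 1 ≠ 0 := by positivity
    rw [poch_succ, show 2 * (j + 1) = (2 * j + 1) + 1 by ring, Nat.factorial_succ (2 * j + 1),
      Nat.factorial_succ (2 * j), Nat.factorial_succ j, show 2 * j + 1 + 1 = 2 * j + 2 by ring,
      pow_add _ (2 * j), pow_succ]
    push_cast at h ⊢
    have e : (1 * (2 * ((j : ℝ) + 1))) * (1 * (2 * (j + 1)) + d - 2) =
        4 * (j + 1) * (d / 2 + j) := by ring
    rw [e] at h
    generalize poch ((d : ℝ) / 2) j = t at *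
    generalize (d : ℝ) / 2 + j = v at *
    field_simp at h ⊢
    linear_combination h

/-- The expansion of the even powers of `‖x + y‖` in zonal harmonics. -/
lemma norm_add_pow_eq_sum (hd : 2 ≤ d) (hY : Y.IsOrthonormal) (x y : EuclideanSpace ℝ (Fin d))
    (j : ℕ) :
    ‖x + y‖ ^ (2 * j) = ∑ m ∈ Finset.range (j + 1), ∑ i ∈ Finset.range (j - m + 1),
      j.factorial * poch ((d : ℝ) / 2) j /
        (i.factorial * (j - m - i).factorial * poch ((d : ℝ) / 2) (m + i) *
          poch ((d : ℝ) / 2) (j - i)) *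
        (‖x‖ ^ (2 * (j - m - i)) * ‖y‖ ^ (2 * i) * zonalKernel Y m x y) := by
  have hd' : (2 : ℝ) ≤ d := by exact_mod_cast hd
  have hp : ∀ k, poch ((d : ℝ) / 2) k ≠ 0 := fun k => (poch_pos (by linarith) k).ne'
  have h := sphereMean_linForm_pow hd (x + y) j
  rw [linForm_add, add_pow, map_sum] at h
  have h2 : ∀ k ∈ Finset.range (2 * j + 1), sphereMean d (linForm x ^ k * linForm y ^ (2 * j - k) *
      ((2 * j).choose k : MvPolynomial (Fin d) ℝ)) =
      ∑ i ∈ Finset.range (k / 2 + 1), ∑ i' ∈ Finset.range ((2 * j - k) / 2 + 1),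
        if k - 2 * i = 2 * j - k - 2 * i' then ((2 * j).choose k : ℝ) * (linFormCoeff d k i *
          linFormCoeff d (2 * j - k) i' * ‖x‖ ^ (2 * i) * ‖y‖ ^ (2 * i') *
            zonalKernel Y (k - 2 * i) x y) else 0 := by
    intro k _
    rw [mul_comm, ← map_natCast C, C_mul', map_smul, linForm_pow_eq_sum hd hY x k,
      linForm_pow_eq_sum hd hY y (2 * j - k), Finset.sum_mul_sum, map_sum, smul_eq_mul,
      Finset.mul_sum]
    refine Finset.sum_congr rfl fun i _ => ?_
    rw [map_sum, Finset.mul_sum]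
    refine Finset.sum_congr rfl fun i' _ => ?_
    rw [sphereMean_linFormPart_mul hd hY]
    split_ifs <;> simp
  rw [Finset.sum_congr rfl h2] at h
  have hc : ((2 * j).factorial : ℝ) / (4 ^ j * j.factorial * poch ((d : ℝ) / 2) j) ≠ 0 :=
    div_ne_zero (by positivity) (mul_ne_zero (by positivity) (hp j))
  apply mul_left_cancel₀ hc
  rw [← h, Finset.mul_sum, Finset.sum_sigma']
  simp_rw [Finset.mul_sum]
  rw [Finset.sum_sigma', Finset.sum_sigma', ← Finset.sum_filter]
  -- Orthogonality keeps the triples `(k, i, i')` with `k - 2i = 2j - k - 2i'`. Calling this common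
  -- degree `m` forces `i = j - m - i'` and `k = m + 2i`, so `(m, i')` indexes them.
  refine Finset.sum_bij'
    (fun z _ => ⟨z.1.1 - 2 * z.1.2, z.2⟩)
    (fun w _ => ⟨⟨w.1 + 2 * (j - w.1 - w.2), j - w.1 - w.2⟩, w.2⟩) ?_ ?_ ?_ ?_ ?_
  · rintro ⟨⟨k, i⟩, i'⟩ hz
    simp only [Finset.mem_filter, Finset.mem_sigma, Finset.mem_range] at hz ⊢
    omega
  · rintro ⟨m, i⟩ hw
    simp only [Finset.mem_filter, Finset.mem_sigma, Finset.mem_range] at hw ⊢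
    omega
  · rintro ⟨⟨k, i⟩, i'⟩ hz
    simp only [Finset.mem_filter, Finset.mem_sigma, Finset.mem_range] at hz
    have e1 : j - (k - 2 * i) - i' = i := by omega
    have e2 : k - 2 * i + 2 * i = k := by omega
    simp only [e1, e2]
  · rintro ⟨m, i⟩ hw
    simp only [Finset.mem_sigma, Finset.mem_range] at hw
    have e1 : m + 2 * (j - m - i) - 2 * (j - m - i) = m := by omega
    simp only [e1]
  · rintro ⟨⟨k, i⟩, i'⟩ hz
    simp only [Finset.mem_filter, Finset.mem_sigma, Finset.mem_range] at hz
    obtain ⟨m, rfl⟩ : ∃ m, k = m + 2 * i := ⟨k - 2 * i, by omega⟩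
    obtain rfl : j = m + i + i' := by omega
    simp only [Nat.add_sub_cancel]
    rw [show m + i + i' - m - i' = i by omega,
      linFormCoeff, linFormCoeff, show 2 * (m + i + i') - (m + 2 * i) = m + 2 * i' by omega,
      show m + 2 * i - i = m + i by omega, show m + 2 * i' - i' = m + i' by omega,
      Nat.cast_choose ℝ (show m + 2 * i ≤ 2 * (m + i + i') by omega),
      show 2 * (m + i + i') - (m + 2 * i) = m + 2 * i' by omega,
      show (4 : ℝ) ^ (m + i + i') = 2 ^ (m + 2 * i) * 2 ^ (m + 2 * i') by
        rw [show (4 : ℝ) = 2 ^ 2 by norm_num, ← pow_mul, ← pow_add]; congr 1; ring]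
    have h1 := hp (m + i)
    have h2 := hp (m + i')
    have h3 := hp (m + i + i')
    generalize poch ((d : ℝ) / 2) (m + i) = t1 at *
    generalize poch ((d : ℝ) / 2) (m + i') = t2 at *
    generalize poch ((d : ℝ) / 2) (m + i + i') = t3 at *
    field_simp

end Zonal

/-! ### Closed forms of the coefficients on the two sides. -/

section Coefficients

lemma neg_one_pow_mul_self (n : ℕ) : ((-1 : ℝ) ^ n) * (-1) ^ n = 1 := by
  rw [← mul_pow]; simp

/-- The coefficient of `s^i` in the kernel of the Jacobi expansion of degree `M` at `-1`. -/
noncomputable def jacobiKernelCoeff (M : ℕ) (α γ : ℝ) (i : ℕ) : ℝ :=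
  (-1) ^ (M + i) * (poch (α + γ + 2) (M + i) /
    ((M - i).factorial * i.factorial * poch (α + 1) i))

/-- The right side is the increment of `jacobiKernelCoeff` from degree `j` to `j + 1`. Starting at
degree `j + 1` lets the factor `α+γ+j+2` cancel. -/
lemma jacobiP_neg_one_div_jacobiH_mul {j i : ℕ} (hi : i ≤ j + 1) {α γ : ℝ} (hα : -1 < α)
    (hγ : -1 < γ) :
    jacobiP (j + 1) α γ (-1) / jacobiH (j + 1) α γ * jacobiCoeff (j + 1) α γ i =
      (-1) ^ (j + 1 + i) * (poch (α + γ + 2) (j + i) * (α + γ + 2 * j + 3) /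
        ((j + 1 - i).factorial * i.factorial * poch (α + 1) i)) := by
  have hj := j.cast_nonneg (α := ℝ)
  obtain ⟨q, hq⟩ := Nat.exists_eq_add_of_le hi
  have e1 := poch_add (α + 1) i q
  have e2 := poch_add (α + γ + 2) j i
  have e3 := poch_succ (α + γ + 2) j
  rw [jacobiP_neg_one _ hα, jacobiH, jacobiCoeff, pow_add _ (j + 1) i, e2,
    show j + 1 - i = q by omega, e3,
    show ((j + 1 : ℕ) : ℝ) + α + γ + 1 = α + γ + 2 + j by push_cast; ring,
    show α + γ + ((j + 1 : ℕ) : ℝ) + 1 = α + γ + 2 + j by push_cast; ring,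
    show α + γ + 2 * ((j + 1 : ℕ) : ℝ) + 1 = α + γ + 2 * j + 3 by push_cast; ring]
  rw [← hq] at e1
  rw [e1]
  have h1 := (poch_pos (show 0 < α + 1 by linarith) i).ne'
  have h2 := (poch_pos (show 0 < α + 1 + i by
    have := i.cast_nonneg (α := ℝ); linarith) q).ne'
  have h3 := (poch_pos (show 0 < γ + 1 by linarith) (j + 1)).ne'
  have h4 := (poch_pos (show 0 < α + γ + 2 by linarith) j).ne'
  have h5 : α + γ + 2 + j ≠ 0 := by linarith
  have h6 : α + γ + 2 * j + 3 ≠ 0 := by linarith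
  have h7 : ((j + 1).factorial : ℝ) ≠ 0 := by positivity
  generalize α + γ + 2 * (j : ℝ) + 3 = x at *
  generalize poch (α + γ + 2) j = y at *
  generalize poch (α + γ + 2 + j) i = w at *
  generalize α + γ + 2 + (j : ℝ) = z at *
  field_simp

/-- The Christoffel–Darboux kernel of the Jacobi polynomials at the endpoint `-1`. -/
lemma sum_jacobiP_neg_one_mul (M : ℕ) {α γ : ℝ} (hα : -1 < α) (hγ : -1 < γ) (hαγ : -1 < α + γ)
    (s : ℝ) :
    ∑ j ∈ Finset.range (M + 1), jacobiP j α γ (-1) / jacobiH j α γ * jacobiP j α γ (1 - 2 * s) =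
      ∑ i ∈ Finset.range (M + 1), jacobiKernelCoeff M α γ i * s ^ i := by
  induction M with
  | zero =>
    have h : α + γ + 1 ≠ 0 := by linarith
    rw [zero_add, Finset.sum_range_one, Finset.sum_range_one, jacobiP_neg_one _ hα,
      jacobiP_one_sub_two_mul _ hα]
    simp [jacobiH, jacobiCoeff, jacobiKernelCoeff, h]
  | succ M ih =>
    have hM := M.cast_nonneg (α := ℝ)
    rw [Finset.sum_range_succ, ih, jacobiP_one_sub_two_mul _ hα, Finset.mul_sum,
      Finset.sum_range_succ _ (M + 1), Finset.sum_range_succ _ (M + 1), ← add_assoc,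
      ← Finset.sum_add_distrib]
    congr 1
    -- With `M = i + q`, the increment rests on `(α+γ+2+M+i) + (M+1-i) = α+γ+2M+3`.
    · refine Finset.sum_congr rfl fun i hi => ?_
      obtain ⟨q, rfl⟩ := Nat.exists_eq_add_of_le (Nat.lt_succ_iff.mp (Finset.mem_range.mp hi))
      rw [← mul_assoc, jacobiP_neg_one_div_jacobiH_mul (by omega) hα hγ, jacobiKernelCoeff,
        jacobiKernelCoeff, show i + q + 1 - i = q + 1 by omega, Nat.add_sub_cancel_left,
        show i + q + 1 + i = (i + q + i) + 1 by ring, poch_succ, Nat.factorial_succ]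
      have h1 := (poch_pos (show 0 < α + 1 by linarith) i).ne'
      have h2 : (q.factorial : ℝ) ≠ 0 := by positivity
      have h3 : (i.factorial : ℝ) ≠ 0 := by positivity
      have h4 : (q : ℝ) + 1 ≠ 0 := by positivity
      push_cast
      field_simp
      ring
    · rw [← mul_assoc, jacobiP_neg_one_div_jacobiH_mul le_rfl hα hγ, jacobiKernelCoeff,
        show M + 1 + (M + 1) = (M + (M + 1)) + 1 by ring, poch_succ (α + γ + 2)]
      push_cast
      ring

lemma jacobiP_one_div_jacobiH (n : ℕ) {a b : ℝ} (ha : 0 < a) (hb : 0 ≤ b) :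
    jacobiP n a b 1 / jacobiH n a b =
      poch (a + b + 2) n * (a + b + 2 * n + 1) / (poch (b + 1) n * (a + b + n + 1)) := by
  have hn := n.cast_nonneg (α := ℝ)
  rw [jacobiP_one n (by linarith), jacobiH]
  have h1 := (poch_pos (show 0 < a + 1 by linarith) n).ne'
  have h2 := (poch_pos (show 0 < b + 1 by linarith) n).ne'
  have h3 := (poch_pos (show 0 < a + b + 2 by linarith) n).ne'
  have h4 : a + b + 2 * n + 1 ≠ 0 := by linarith
  have h5 : a + b + n + 1 ≠ 0 := by linarith
  have h6 : (n.factorial : ℝ) ≠ 0 := by positivity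
  generalize a + b + 2 * (n : ℝ) + 1 = x at *
  generalize a + b + (n : ℝ) + 1 = z at *
  field_simp

/-- The common coefficient of the two sides of the kernel identity. -/
noncomputable def kernelCoeff (a b : ℝ) (m i N : ℕ) : ℝ :=
  (-1) ^ N * poch (a + 1) (m + 2 * i + N) / (N.factorial * i.factorial * poch (b + 1) (m + i))

/-- For `α = b + m` one has `α + γ + 2 = a + 1 + m`, so the prefactor `(a+1)_m / (b+1)_m` from the
norms concatenates with the Pochhammer symbols of the kernel. -/
lemma jacobiKernelCoeff_eq_kernelCoeff (m i N : ℕ) {a b γ : ℝ} (ha : a = γ + b + 1) (hb : 0 ≤ b) :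
    poch (a + 1) m / poch (b + 1) m * jacobiKernelCoeff (i + N) (b + m) γ i =
      kernelCoeff a b m i N := by
  have h1 := (poch_pos (show 0 < b + 1 by linarith) m).ne'
  have h2 := (poch_pos (show 0 < b + 1 + m by positivity) i).ne'
  rw [jacobiKernelCoeff, kernelCoeff, show m + 2 * i + N = m + (i + N + i) by ring, poch_add (a + 1) m,
    poch_add (b + 1), show b + m + γ + 2 = a + 1 + m by rw [ha]; ring,
    show b + m + 1 = b + 1 + m by ring, Nat.add_sub_cancel_left,
    show (-1 : ℝ) ^ (i + N + i) = (-1) ^ N by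
      rw [show i + N + i = i + i + N by ring, pow_add, pow_add, neg_one_pow_mul_self, one_mul]]
  field_simp

/-- The mean of `u^(m+2l) (1-u)^(m+2i)` against the Jacobi weight, times the coefficients. -/
lemma sum_jacobiCoeff_mul_eq_kernelCoeff (m i N : ℕ) {a b : ℝ} (ha : 0 < a) (hb : 0 ≤ b) :
    jacobiP (m + i + N) a b 1 / jacobiH (m + i + N) a b * ((-1) ^ (m + i + N) *
      ∑ l ∈ Finset.range (N + 1), jacobiCoeff (m + i + N) b a (m + i + l) *
        ((m + i + l).factorial * poch (b + 1) (m + i + l) / (i.factorial * l.factorial *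
          poch (b + 1) (m + i) * poch (b + 1) (m + l))) *
        (poch (b + 1) (m + 2 * l) * poch (a + 1) (m + 2 * i) /
          poch (b + a + 2) (m + 2 * l + (m + 2 * i)))) = kernelCoeff a b m i N := by
  set n := m + i + N with hn
  set B : ℝ := a + b + 2 + 2 * (m + i : ℕ) with hB
  set A : ℝ := b + 1 + m with hA
  have p : ∀ (c : ℝ) (_ : 0 < c) (k : ℕ), poch c k ≠ 0 := fun c hc k => (poch_pos hc k).ne'
  have hb1 : 0 < b + 1 := by linarith
  have hmu : 0 < a + b + 2 := by linarith
  have hBpos : 1 < B := by rw [hB]; have := (m + i).cast_nonneg (α := ℝ); linarith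
  -- Factors independent of `l` are pulled out; `A` and `B` are chosen so that the rest is the
  -- summand of `sum_poch_four_F_three`.
  have hsum : ∀ l ∈ Finset.range (N + 1), jacobiCoeff n b a (m + i + l) *
        ((m + i + l).factorial * poch (b + 1) (m + i + l) / (i.factorial * l.factorial *
          poch (b + 1) (m + i) * poch (b + 1) (m + l))) *
        (poch (b + 1) (m + 2 * l) * poch (a + 1) (m + 2 * i) /
          poch (b + a + 2) (m + 2 * l + (m + 2 * i))) =
      (-1) ^ (m + i) * (poch (b + 1) n * poch (a + 1) (m + 2 * i) * poch (n + a + b + 1) (m + i) /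
        (i.factorial * poch (b + 1) (m + i) * poch (a + b + 2) (2 * (m + i)) * N.factorial)) *
        ((-1) ^ l * (N.choose l : ℝ) * poch (N + B - 1) l * poch (A + l) l / poch B (2 * l)) := by
    intro l hl
    obtain ⟨q, rfl⟩ := Nat.exists_eq_add_of_le (Nat.lt_succ_iff.mp (Finset.mem_range.mp hl))
    have e1 : poch (b + 1) n = poch (b + 1) (m + i + l) * poch (b + 1 + (m + i + l : ℕ)) q := by
      rw [← poch_add, hn]; congr 1; ring
    have e2 : poch (n + b + a + 1) (m + i + l) =
        poch (n + a + b + 1) (m + i) * poch ((l + q : ℕ) + B - 1) l := by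
      rw [show (n : ℝ) + b + a + 1 = n + a + b + 1 by ring, poch_add]
      congr 2; rw [hB, hn]; push_cast; ring
    have e3 : poch (b + a + 2) (m + 2 * l + (m + 2 * i)) =
        poch (a + b + 2) (2 * (m + i)) * poch B (2 * l) := by
      rw [show m + 2 * l + (m + 2 * i) = 2 * (m + i) + 2 * l by ring, poch_add,
        show b + a + 2 = a + b + 2 by ring, hB]
      push_cast; rfl
    have e4 : poch (b + 1) (m + 2 * l) = poch (b + 1) (m + l) * poch (A + l) l := by
      rw [show m + 2 * l = m + l + l by ring, poch_add, hA]
      push_cast; ring_nf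
    rw [jacobiCoeff, show n - (m + i + l) = q by omega, e1, e2, e3, e4,
      Nat.cast_choose ℝ (Nat.le_add_right l q), Nat.add_sub_cancel_left, pow_add]
    have h1 := p (b + 1) hb1 (m + i)
    have h2 := p (b + 1) hb1 (m + l)
    have h3 := p (a + b + 2) hmu (2 * (m + i))
    have h4 := p B (by linarith) (2 * l)
    generalize poch (b + 1) (m + i) = t1 at *
    generalize poch (b + 1) (m + l) = t2 at *
    generalize poch (a + b + 2) (2 * (m + i)) = t3 at *
    generalize poch B (2 * l) = t4 at *
    generalize poch (b + 1 + (m + i + l : ℕ)) q = t5 at *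
    generalize poch (n + a + b + 1) (m + i) = t6 at *
    generalize poch ((l + q : ℕ) + B - 1) l = t7 at *
    generalize poch (A + l) l = t8 at *
    field_simp
  rw [Finset.sum_congr rfl hsum, ← Finset.mul_sum, sum_poch_four_F_three N A hBpos,
    jacobiP_one_div_jacobiH n ha hb, kernelCoeff]
  have hN := N.cast_nonneg (α := ℝ)
  have hn0 := n.cast_nonneg (α := ℝ)
  have e1 : poch (a + 1) (m + 2 * i + N) = poch (a + 1) (m + 2 * i) * poch (B - A) N := by
    rw [poch_add]; congr 2; rw [hB, hA]; push_cast; ring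
  have e2 : a + b + 2 * n + 1 = B + 2 * N - 1 := by rw [hB, hn]; push_cast; ring
  have e3 : poch (a + b + 2) n * (poch (n + a + b + 1) (m + i) * (B + N - 1)) =
      (a + b + n + 1) * (poch (a + b + 2) (2 * (m + i)) * poch B N) := by
    have q1 : poch (a + b + 2) (2 * (m + i)) * poch B N = poch (a + b + 2) (n + (m + i)) := by
      rw [show n + (m + i) = 2 * (m + i) + N by omega, poch_add (a + b + 2), hB]
      push_cast; rfl
    have q2 := poch_succ (n + a + b + 1) (m + i)
    rw [poch_succ_left, show (n : ℝ) + a + b + 1 + 1 = a + b + 2 + n by ring,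
      show (n : ℝ) + a + b + 1 + (m + i : ℕ) = B + N - 1 by rw [hB, hn]; push_cast; ring] at q2
    rw [← q2, q1, poch_add (a + b + 2) n]; ring
  rw [e1, e2]
  have s1 := neg_one_pow_mul_self (m + i)
  have h1 := p (b + 1) hb1 (m + i)
  have h2 := p (b + 1) hb1 n
  have h3 := p (a + b + 2) hmu (2 * (m + i))
  have h4 := p B (by linarith) N
  have h5 : B + 2 * N - 1 ≠ 0 := by linarith
  have h6 : a + b + n + 1 ≠ 0 := by linarith
  have h7 : (N.factorial : ℝ) ≠ 0 := by positivity
  have h8 : (i.factorial : ℝ) ≠ 0 := by positivity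
  have s2 : ((-1 : ℝ) ^ n) * (-1) ^ (m + i) = (-1) ^ N := by
    rw [hn, pow_add _ (m + i) N, mul_right_comm, s1, one_mul]
  rw [← s2]
  generalize poch (b + 1) (m + i) = t1 at *
  generalize poch (b + 1) n = t2 at *
  generalize poch (a + b + 2) (2 * (m + i)) = t3 at *
  generalize poch B N = t4 at *
  generalize poch (n + a + b + 1) (m + i) = t5 at *
  generalize B + 2 * (N : ℝ) - 1 = t6 at *
  generalize a + b + (n : ℝ) + 1 = t7 at *
  generalize poch (a + b + 2) n = t8 at *
  generalize B + (N : ℝ) - 1 = t9 at *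
  generalize poch (B - A) N = t10 at *
  generalize (-1 : ℝ) ^ n = t11 at *
  field_simp
  linear_combination (t11 * poch (a + 1) (m + 2 * i) * t10) * e3

end Coefficients

/-! ### Expansion of the kernel and of the integrand. -/

section Kernel

variable {d : ℕ} {Y : HarmonicBasis d}

lemma HarmonicBasis.val_smul (Y : HarmonicBasis d) (m : ℕ)
    (l : Fin (Module.finrank ℝ (harmonicSpace d m))) (r : ℝ) (x : EuclideanSpace ℝ (Fin d)) :
    Y.val m l (r • x) = r ^ m * Y.val m l x :=
  eval_smul_of_isHomogeneous (mem_harmonicSpace.mp (Y m l).2).1 r x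

lemma zonalKernel_smul_smul (Y : HarmonicBasis d) (m : ℕ) (r t : ℝ)
    (x y : EuclideanSpace ℝ (Fin d)) :
    zonalKernel Y m (r • x) (t • y) = r ^ m * t ^ m * zonalKernel Y m x y := by
  simp only [zonalKernel, Y.val_smul, Finset.mul_sum]
  exact Finset.sum_congr rfl fun l _ => by ring

/-- For `s > 0` the powers of `s` cancel by homogeneity. At the apex `y = 0`: both sides vanish if
`m > 0`, and if `m = 0` the convention `0^0 = 1` applies. -/
lemma basisQ_of_mem_surface (β γ : ℝ) (Y : HarmonicBasis d) (n m : ℕ)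
    (l : Fin (Module.finrank ℝ (harmonicSpace d m))) {y : EuclideanSpace ℝ (Fin d)} {s : ℝ}
    (hys : (y, s) ∈ surface d) :
    basisQ β γ Y n m l (y, s) =
      jacobiP (n - m) (β + m + ((d : ℝ) - 1) / 2) γ (1 - 2 * s) * Y.val m l y := by
  obtain ⟨h1, h2, -⟩ := hys
  simp only at h1 h2
  rw [basisQ]
  congr 1
  simp only
  rw [Y.val_smul]
  rcases h2.eq_or_lt with rfl | hs
  · rcases Nat.eq_zero_or_pos m with rfl | hm
    · simp
    · have hy : y = 0 := by simpa using h1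
      have h0 := Y.val_smul m l 0 0
      rw [smul_zero, zero_pow hm.ne', zero_mul] at h0
      rw [hy, h0, mul_zero, mul_zero]
  · rw [← mul_assoc, Real.sqrt_eq_rpow, ← Real.rpow_neg hs.le, ← Real.rpow_natCast,
      ← Real.rpow_mul hs.le, ← Real.rpow_add hs]
    rw [show (m : ℝ) / 2 + -(1 / 2) * m = 0 by ring, Real.rpow_zero, one_mul]

lemma smul_mem_surface {ξ : EuclideanSpace ℝ (Fin d)} (hξ : ‖ξ‖ = 1) {t : ℝ} (h0 : 0 ≤ t)
    (h1 : t ≤ 1) : (Real.sqrt t • ξ, t) ∈ surface d := by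
  refine ⟨?_, h0, h1⟩
  simp [norm_smul, hξ, Real.sq_sqrt h0]

/-- The square norm of the basis functions on the surface of the paraboloid. -/
lemma surfaceInner_basisQ (hd : 2 ≤ d) {γ b : ℝ} (hγ : -1 < γ) (hb : b = ((d : ℝ) - 2) / 2)
    (hY : Y.IsOrthonormal) {n m : ℕ} (l : Fin (Module.finrank ℝ (harmonicSpace d m))) :
    surfaceInner d (-1 / 2) γ (basisQ (-1 / 2) γ Y n m l) (basisQ (-1 / 2) γ Y n m l) =
      poch (b + 1) m / poch (γ + b + 2) m * jacobiH (n - m) (b + m) γ := by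
  have hd' : (2 : ℝ) ≤ d := by exact_mod_cast hd
  have hb0 : 0 ≤ b := by rw [hb]; linarith
  have hm := m.cast_nonneg (α := ℝ)
  have hα : (-1 / 2 : ℝ) + m + ((d : ℝ) - 1) / 2 = b + m := by rw [hb]; ring
  have : NeZero d := ⟨by omega⟩
  have hA := (sphereArea_pos (d := d)).ne'
  have hsq : sphereIntegral d (fun ξ => Y.val m l ξ * Y.val m l ξ) = sphereArea d := by
    have := hY m l l
    rw [if_pos rfl] at this
    rw [one_div, inv_mul_eq_iff_eq_mul₀ hA, mul_one] at this
    exact this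
  have hint : surfaceIntegral d (fun p => basisQ (-1 / 2) γ Y n m l p *
      basisQ (-1 / 2) γ Y n m l p * surfaceWeight (-1 / 2) γ p.2) =
      sphereArea d * ∫ t in (0 : ℝ)..1, t ^ (b + m) * (1 - t) ^ γ *
        jacobiP (n - m) (b + m) γ (1 - 2 * t) ^ 2 := by
    rw [surfaceIntegral, ← intervalIntegral.integral_const_mul]
    refine intervalIntegral.integral_congr_Ioo_of_le zero_le_one fun t ht => ?_
    have hs : sphereIntegral d (fun ξ => basisQ (-1 / 2) γ Y n m l (Real.sqrt t • ξ, t) *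
        basisQ (-1 / 2) γ Y n m l (Real.sqrt t • ξ, t) * surfaceWeight (-1 / 2) γ t) =
        (jacobiP (n - m) (b + m) γ (1 - 2 * t) ^ 2 * t ^ m * surfaceWeight (-1 / 2) γ t) *
          sphereArea d := by
      rw [← hsq, sphereIntegral, sphereIntegral, ← integral_const_mul]
      refine integral_congr_ae (Filter.Eventually.of_forall fun ξ => ?_)
      have hξ : ‖ξ.1‖ = 1 := by simp
      simp only
      rw [basisQ_of_mem_surface _ _ _ _ _ _ (smul_mem_surface hξ ht.1.le ht.2.le), hα,
        Y.val_smul]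
      have : t ^ m = Real.sqrt t ^ m * Real.sqrt t ^ m := by
        rw [← mul_pow, Real.mul_self_sqrt ht.1.le]
      rw [this]; ring
    simp only
    rw [hs, surfaceWeight, Real.rpow_add_natCast ht.1.ne',
      show b = ((d : ℝ) - 1) / 2 + (-1 / 2) by rw [hb]; ring, Real.rpow_add ht.1]
    ring
  have hmean := betaMean_jacobiP_sq (n - m) (α := b + m) (β := γ) (by linarith) hγ (by linarith)
  rw [betaMean] at hmean
  -- The factor `t^m` from homogeneity moves the Jacobi weight from `b` to `b + m`; renormalizing it
  -- produces the Pochhammer quotient.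
  have hC := jacobiC_add (α := b) (β := γ) (by linarith) hγ m 0
  rw [Nat.cast_zero, add_zero, poch_zero, mul_one, add_zero,
    show b + γ + 2 = γ + b + 2 by ring] at hC
  rw [surfaceInner, hint, show (-1 / 2 : ℝ) + ((d : ℝ) - 1) / 2 = b by rw [hb]; ring, hC, ← hmean]
  field_simp

lemma kernelK_eq_sum (hd : 2 ≤ d) {γ b : ℝ} (hγ : -1 < γ) (hb : b = ((d : ℝ) - 2) / 2)
    (hY : Y.IsOrthonormal) (n : ℕ) {ξ y : EuclideanSpace ℝ (Fin d)} {s : ℝ} (hξ : ‖ξ‖ = 1)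
    (hys : (y, s) ∈ surface d) :
    kernelK (-1 / 2) γ Y n (ξ, 1) (y, s) = ∑ m ∈ Finset.range (n + 1),
      ∑ i ∈ Finset.range (n - m + 1),
        kernelCoeff (γ + b + 1) b m i (n - m - i) * (s ^ i * zonalKernel Y m ξ y) := by
  have hd' : (2 : ℝ) ≤ d := by exact_mod_cast hd
  have hb0 : 0 ≤ b := by rw [hb]; linarith
  have hξ1 : (ξ, (1 : ℝ)) ∈ surface d := ⟨by simp [hξ], zero_le_one, le_rfl⟩
  have h1 : kernelK (-1 / 2) γ Y n (ξ, 1) (y, s) = ∑ k ∈ Finset.range (n + 1),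
      ∑ m ∈ Finset.range (k + 1), poch (γ + b + 2) m / poch (b + 1) m *
        (jacobiP (k - m) (b + m) γ (-1) / jacobiH (k - m) (b + m) γ *
          jacobiP (k - m) (b + m) γ (1 - 2 * s)) * zonalKernel Y m ξ y := by
    refine Finset.sum_congr rfl fun k _ => Finset.sum_congr rfl fun m _ => ?_
    rw [zonalKernel, Finset.mul_sum]
    refine Finset.sum_congr rfl fun l _ => ?_
    have hα : (-1 / 2 : ℝ) + m + ((d : ℝ) - 1) / 2 = b + m := by rw [hb]; ring
    have p1 := (poch_pos (show 0 < γ + b + 2 by linarith) m).ne'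
    have p2 := (poch_pos (show 0 < b + 1 by linarith) m).ne'
    rw [surfaceInner_basisQ hd hγ hb hY, basisQ_of_mem_surface _ _ _ _ _ _ hξ1,
      basisQ_of_mem_surface _ _ _ _ _ _ hys, hα, show (1 : ℝ) - 2 * 1 = -1 by norm_num]
    field_simp
  -- Summing over `j = k - m` with `m` fixed outside makes the inner sum a Jacobi kernel of degree
  -- `n - m` at `-1`.
  have h2 : ∑ k ∈ Finset.range (n + 1),
      ∑ m ∈ Finset.range (k + 1), poch (γ + b + 2) m / poch (b + 1) m *
        (jacobiP (k - m) (b + m) γ (-1) / jacobiH (k - m) (b + m) γ *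
          jacobiP (k - m) (b + m) γ (1 - 2 * s)) * zonalKernel Y m ξ y =
      ∑ m ∈ Finset.range (n + 1), ∑ j ∈ Finset.range (n - m + 1),
        poch (γ + b + 2) m / poch (b + 1) m * (jacobiP j (b + m) γ (-1) /
          jacobiH j (b + m) γ * jacobiP j (b + m) γ (1 - 2 * s)) * zonalKernel Y m ξ y := by
    rw [Finset.sum_sigma', Finset.sum_sigma']
    refine Finset.sum_bij' (fun z _ => ⟨z.2, z.1 - z.2⟩) (fun w _ => ⟨w.1 + w.2, w.1⟩)
      ?_ ?_ ?_ ?_ ?_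
    · rintro ⟨k, m⟩ hz
      simp only [Finset.mem_sigma, Finset.mem_range] at hz ⊢
      omega
    · rintro ⟨m, j⟩ hw
      simp only [Finset.mem_sigma, Finset.mem_range] at hw ⊢
      omega
    · rintro ⟨k, m⟩ hz
      simp only [Finset.mem_sigma, Finset.mem_range] at hz
      simp only [Nat.add_sub_cancel' (Nat.lt_succ_iff.mp hz.2)]
    · rintro ⟨m, j⟩ _
      simp only [Nat.add_sub_cancel_left]
    · rintro ⟨k, m⟩ _
      rfl
  rw [h1, h2]
  refine Finset.sum_congr rfl fun m _ => ?_
  have hm := m.cast_nonneg (α := ℝ)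
  rw [← Finset.sum_mul, ← Finset.mul_sum, sum_jacobiP_neg_one_mul _ (by linarith) hγ (by linarith),
    Finset.mul_sum, Finset.sum_mul]
  refine Finset.sum_congr rfl fun i hi => ?_
  obtain ⟨N, hN⟩ := Nat.exists_eq_add_of_le (Nat.lt_succ_iff.mp (Finset.mem_range.mp hi))
  rw [hN, Nat.add_sub_cancel_left, ← jacobiKernelCoeff_eq_kernelCoeff m i N rfl hb0,
    show γ + b + 1 + 1 = γ + b + 2 by ring]
  ring

/-- This identity is what makes the integrand accessible to harmonic analysis: `z'` becomes a
function of the norm of a sum of two vectors. -/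
lemma zPrime_two_mul_sub_one {ξ y : EuclideanSpace ℝ (Fin d)} {s : ℝ} (hξ : ‖ξ‖ = 1)
    (hys : (y, s) ∈ surface d) (u : ℝ) :
    zPrime ξ y s (2 * u - 1) = 2 * ‖u • ξ + (1 - u) • y‖ ^ 2 - 1 := by
  have h : ‖y‖ ^ 2 = s := hys.1
  rw [zPrime, norm_add_sq_real, inner_smul_left, inner_smul_right, norm_smul, norm_smul, mul_pow,
    mul_pow, hξ, h, Real.norm_eq_abs, Real.norm_eq_abs, sq_abs, sq_abs]
  simp only [conj_trivial]
  ring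

/-- The normalized integral against the Jacobi weight on `[-1, 1]`, transferred to `[0, 1]`. -/
lemma jacobiC'_mul_integral (a b : ℝ) (F : ℝ → ℝ) :
    jacobiC' a b * ∫ v in (-1 : ℝ)..1, F v * jacobiWeight a b v =
      betaMean b a (fun u => F (2 * u - 1)) := by
  have h := intervalIntegral.integral_comp_mul_sub (a := 0) (b := 1)
    (fun v => F v * jacobiWeight a b v) (two_ne_zero (α := ℝ)) 1
  rw [show (2 : ℝ) * 0 - 1 = -1 by norm_num, show (2 : ℝ) * 1 - 1 = 1 by norm_num] at h
  have h2 : ∫ u in (0 : ℝ)..1, F (2 * u - 1) * jacobiWeight a b (2 * u - 1) =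
      2 ^ (a + b) * ∫ u in (0 : ℝ)..1, u ^ b * (1 - u) ^ a * F (2 * u - 1) := by
    rw [← intervalIntegral.integral_const_mul]
    refine intervalIntegral.integral_congr_Ioo_of_le zero_le_one fun u hu => ?_
    rw [jacobiWeight, show 1 - (2 * u - 1) = 2 * (1 - u) by ring,
      show 1 + (2 * u - 1) = 2 * u by ring, Real.mul_rpow zero_le_two (sub_nonneg.mpr hu.2.le),
      Real.mul_rpow zero_le_two hu.1.le, Real.rpow_add two_pos]
    ring
  rw [h2, smul_eq_mul] at h
  have h3 : ∫ v in (-1 : ℝ)..1, F v * jacobiWeight a b v =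
      2 * (2 ^ (a + b) * ∫ u in (0 : ℝ)..1, u ^ b * (1 - u) ^ a * F (2 * u - 1)) := by
    rw [h]; ring
  have h4 : (2 : ℝ) ^ (-a - b - 1) * (2 * 2 ^ (a + b)) = 1 := by
    rw [mul_comm 2, ← Real.rpow_add_one two_ne_zero, ← Real.rpow_add two_pos,
      show -a - b - 1 + (a + b + 1) = 0 by ring, Real.rpow_zero]
  have h5 : jacobiC a b = jacobiC b a := by
    rw [jacobiC, jacobiC, add_comm a b, mul_comm (Real.Gamma (a + 1))]
  rw [h3, betaMean, jacobiC', ← h5]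
  linear_combination (jacobiC a b *
    ∫ u in (0 : ℝ)..1, u ^ b * (1 - u) ^ a * F (2 * u - 1)) * h4

/-- The index `l` is `j - m - i`, where `j` is the power of `‖uξ + (1-u)y‖²`. The variable `u` is
thereby separated from `s` and `Z_m(ξ,y)`, ready for beta integrals. -/
lemma jacobiP_zPrime_eq_sum (hd : 2 ≤ d) {a b : ℝ} (ha : 0 < a) (hb : b = ((d : ℝ) - 2) / 2)
    (hY : Y.IsOrthonormal) (n : ℕ) {ξ y : EuclideanSpace ℝ (Fin d)} {s : ℝ} (hξ : ‖ξ‖ = 1)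
    (hys : (y, s) ∈ surface d) (u : ℝ) :
    jacobiP n a b (zPrime ξ y s (2 * u - 1)) =
      ∑ w ∈ (Finset.range (n + 1)).sigma fun m => (Finset.range (n - m + 1)).sigma fun i =>
          Finset.range (n - m - i + 1),
        ((-1) ^ n * (jacobiCoeff n b a (w.1 + w.2.1 + w.2.2) *
          ((w.1 + w.2.1 + w.2.2).factorial * poch (b + 1) (w.1 + w.2.1 + w.2.2) /
            (w.2.1.factorial * w.2.2.factorial * poch (b + 1) (w.1 + w.2.1) *
              poch (b + 1) (w.1 + w.2.2)))) * (s ^ w.2.1 * zonalKernel Y w.1 ξ y)) *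
          (u ^ (w.1 + 2 * w.2.2) * (1 - u) ^ (w.1 + 2 * w.2.1)) := by
  have hs : ‖y‖ ^ 2 = s := hys.1
  have hdb : (d : ℝ) / 2 = b + 1 := by rw [hb]; ring
  rw [zPrime_two_mul_sub_one hξ hys, jacobiP_two_mul_sub_one n (by linarith), Finset.mul_sum]
  simp_rw [← pow_mul, norm_add_pow_eq_sum hd hY, hdb, zonalKernel_smul_smul, Finset.mul_sum]
  rw [Finset.sum_sigma', Finset.sum_sigma']
  refine Finset.sum_bij'
    (fun z _ => ⟨z.1.2, ⟨z.2, z.1.1 - z.1.2 - z.2⟩⟩)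
    (fun w _ => ⟨⟨w.1 + w.2.1 + w.2.2, w.1⟩, w.2.1⟩) ?_ ?_ ?_ ?_ ?_
  · rintro ⟨⟨j, m⟩, i⟩ hz
    simp only [Finset.mem_sigma, Finset.mem_range] at hz ⊢
    omega
  · rintro ⟨m, i, l⟩ hw
    simp only [Finset.mem_sigma, Finset.mem_range] at hw ⊢
    omega
  · rintro ⟨⟨j, m⟩, i⟩ hz
    simp only [Finset.mem_sigma, Finset.mem_range] at hz
    have e : m + i + (j - m - i) = j := by omega
    simp only [e]
  · rintro ⟨m, i, l⟩ _
    have e : m + i + l - m - i = l := by omega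
    simp only [e]
  · rintro ⟨⟨j, m⟩, i⟩ hz
    simp only [Finset.mem_sigma, Finset.mem_range] at hz
    obtain ⟨l, rfl⟩ : ∃ l, j = m + i + l := ⟨j - m - i, by omega⟩
    simp only
    rw [show m + i + l - m - i = l by omega, show m + i + l - i = m + l by omega, norm_smul,
      norm_smul, hξ, mul_one, pow_mul, pow_mul, mul_pow, hs, Real.norm_eq_abs, Real.norm_eq_abs,
      sq_abs, sq_abs, mul_pow _ s i, ← pow_mul (1 - u)]
    ring

end Kernel

end Paraboloid

/-! ### Comparison of the coefficients of `s^i * Z_m(ξ,y)`. -/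

theorem mainTheorem11 (d : ℕ) (hd : 2 ≤ d) (γ : ℝ) (hγ : -1 < γ)
    (Y : Paraboloid.HarmonicBasis d) (hY : Y.IsOrthonormal) (n : ℕ)
    (ξ : EuclideanSpace ℝ (Fin d)) (hξ : ‖ξ‖ = 1)
    (y : EuclideanSpace ℝ (Fin d)) (s : ℝ) (hys : (y, s) ∈ Paraboloid.surface d) :
    Paraboloid.kernelK (-1 / 2) γ Y n (ξ, 1) (y, s) =
      Paraboloid.jacobiP n (γ + (d : ℝ) / 2) (((d : ℝ) - 2) / 2) 1 /
          Paraboloid.jacobiH n (γ + (d : ℝ) / 2) (((d : ℝ) - 2) / 2) *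
        (Paraboloid.jacobiC' (γ + (d : ℝ) / 2) (((d : ℝ) - 2) / 2) *
          ∫ v in (-1 : ℝ)..1,
            Paraboloid.jacobiP n (γ + (d : ℝ) / 2) (((d : ℝ) - 2) / 2)
                (Paraboloid.zPrime ξ y s v) *
              Paraboloid.jacobiWeight (γ + (d : ℝ) / 2) (((d : ℝ) - 2) / 2) v) := by
  have hd' : (2 : ℝ) ≤ d := by exact_mod_cast hd
  obtain ⟨b, hb⟩ : ∃ b : ℝ, b = ((d : ℝ) - 2) / 2 := ⟨_, rfl⟩
  have hb0 : 0 ≤ b := by rw [hb]; linarith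
  obtain ⟨a, ha⟩ : ∃ a : ℝ, a = γ + b + 1 := ⟨_, rfl⟩
  have ha0 : 0 < a := by rw [ha]; linarith
  rw [show γ + (d : ℝ) / 2 = a by rw [ha, hb]; ring, ← hb, Paraboloid.jacobiC'_mul_integral,
    Paraboloid.kernelK_eq_sum hd hγ hb hY n hξ hys, ← ha]
  simp_rw [Paraboloid.jacobiP_zPrime_eq_sum hd ha0 hb hY n hξ hys]
  rw [Paraboloid.betaMean_sum (by linarith) (by linarith) _ _ _ (fun w => by fun_prop),
    Finset.mul_sum, Finset.sum_sigma]
  refine Finset.sum_congr rfl fun m hm => ?_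
  rw [Finset.sum_sigma]
  refine Finset.sum_congr rfl fun i hi => ?_
  obtain ⟨N, rfl⟩ : ∃ N, n = m + i + N := ⟨n - m - i, by
    have := Finset.mem_range.mp hm
    have := Finset.mem_range.mp hi
    omega⟩
  -- With `m` and `i` fixed, the remaining sum over `l` on the integral side must equal
  -- `kernelCoeff`.
  rw [show m + i + N - m - i = N by omega,
    ← Paraboloid.sum_jacobiCoeff_mul_eq_kernelCoeff m i N ha0 hb0, Finset.mul_sum, Finset.mul_sum, Finset.sum_mul]
  refine Finset.sum_congr rfl fun l _ => ?_
  rw [Paraboloid.betaMean_pow (by linarith) (by linarith)]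
  ring
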